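/- Let $n \ge 0$ be an integer. For a trilinear form $T : A^* \times B^* \times C^* \to \mathbb{C}$ on finite-dimensional complex vector spaces (equivalently, a tensor $T \in A \otimes B \otimes C$), put $\hat\Sigma^{AB}_T = \{(\alpha,\beta) \in A^* \times B^* : T(\alpha,\beta,\cdot) = 0\}$; the geometric rank of $T$ is $GR(T) = \dim(A^* \times B^*) - \dim \hat\Sigma^{AB}_T$, the codimension of this affine variety. Let $$SM_{\langle n\rangle}(X,Y,Z) = \mathrm{tr}(XYZ) + \mathrm{tr}(YXZ), \qquad X, Y, Z \in \mathrm{Mat}_{n\times n}(\mathbb{C}),$$ be the symmetrized matrix multiplication tensor. Then $\hat\Sigma^{AB}_{SM_{\langle n\rangle}}$ is the anticommuting variety $\{(X,Y) \in \mathrm{Mat}_{n\times n}(\mathbb{C})^2 : XY + YX = 0\}$, this variety has dimension $n^2 + \lfloor n/2 \rfloor$, and $$GR(SM_{\langle n\rangle}) = n^2 - \left\lfloor \frac{n}{2} \right\rfloor .$$ -/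

import Mathlib

/-- The coordinate ring `ℂ[X]` of a subset `X` of a finite-dimensional complex vector space `V`:
the ring of restrictions to `X` of polynomial functions on `V`, that is, the algebra of functions
on `X` generated by the restrictions of the linear forms on `V`. -/
def coordinateRing {V : Type*} [AddCommGroup V] [Module ℂ V] (X : Set V) :
    Subalgebra ℂ (X → ℂ) :=
  Algebra.adjoin ℂ {f : X → ℂ | ∃ φ : V →ₗ[ℂ] ℂ, ∀ x : X, f x = φ x}

/-- The dimension of an affine variety `X ⊆ V`: the Krull dimension of its coordinate ring.
(For an arbitrary subset this is the dimension of the Zariski closure; the empty set has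
dimension `⊥`.) -/
noncomputable def varietyDim {V : Type*} [AddCommGroup V] [Module ℂ V] (X : Set V) :
    WithBot ℕ∞ :=
  ringKrullDim (coordinateRing X)

/-- For a tensor `T ∈ A ⊗ B ⊗ C`, regarded as a trilinear form on the dual spaces
`A* = A'`, `B* = B'`, `C* = C'`, the variety of all `(α, β) ∈ A* × B*` with `T(α, β, ·) = 0`. -/
def kernelVariety {A' B' C' : Type*} [AddCommGroup A'] [Module ℂ A'] [AddCommGroup B']
    [Module ℂ B'] [AddCommGroup C'] [Module ℂ C'] (T : A' →ₗ[ℂ] B' →ₗ[ℂ] C' →ₗ[ℂ] ℂ) :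
    Set (A' × B') :=
  {p | ∀ γ : C', T p.1 p.2 γ = 0}

/-- The geometric rank of a tensor on finite-dimensional spaces: the codimension of
`{(α, β) | T(α, β, ·) = 0}` in `A* × B*`. The variety contains `(0, 0)` and its dimension is at
most `dim (A* × B*)`, so the conversion of the dimension to a natural number and the subtraction
are never degenerate. -/
noncomputable def geometricRank {A' B' C' : Type*} [AddCommGroup A'] [Module ℂ A']
    [FiniteDimensional ℂ A'] [AddCommGroup B'] [Module ℂ B'] [FiniteDimensional ℂ B']
    [AddCommGroup C'] [Module ℂ C'] [FiniteDimensional ℂ C']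
    (T : A' →ₗ[ℂ] B' →ₗ[ℂ] C' →ₗ[ℂ] ℂ) : ℕ :=
  Module.finrank ℂ (A' × B') - ((varietyDim (kernelVariety T)).unbotD 0).toNat

/-- The symmetrized matrix multiplication tensor, `(X, Y, Z) ↦ tr (XYZ) + tr (YXZ)`. -/
noncomputable def symmetrizedMatMul (n : ℕ) :
    Matrix (Fin n) (Fin n) ℂ →ₗ[ℂ] Matrix (Fin n) (Fin n) ℂ →ₗ[ℂ]
      Matrix (Fin n) (Fin n) ℂ →ₗ[ℂ] ℂ :=
  LinearMap.mk₂ ℂ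
    (fun X Y =>
      { toFun := fun Z => (X * Y * Z).trace + (Y * X * Z).trace
        map_add' := fun Z Z' => by simp only [mul_add, Matrix.trace_add]; ring
        map_smul' := fun c Z => by simp [mul_add] })
    (fun X X' Y => by
      ext1 Z
      simp only [LinearMap.coe_mk, AddHom.coe_mk, LinearMap.add_apply, mul_add, add_mul,
        Matrix.trace_add]
      ring)
    (fun c X Y => by
      ext1 Z
      simp [mul_add])
    (fun X Y Y' => by
      ext1 Z
      simp only [LinearMap.coe_mk, AddHom.coe_mk, LinearMap.add_apply, mul_add, add_mul,
        Matrix.trace_add]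
      ring)
    (fun c X Y => by
      ext1 Z
      simp [mul_add])

theorem symmetrizedMatMul_apply (n : ℕ) (X Y Z : Matrix (Fin n) (Fin n) ℂ) :
    symmetrizedMatMul n X Y Z = (X * Y * Z).trace + (Y * X * Z).trace :=
  rfl

/-! The trace form is nondegenerate, so the kernel variety is the anticommuting variety `X`, and
everything rests on `dim X = n² + ⌊n/2⌋`.

Upper bound. Sort the pairs `(A, B)` by the Jordan type of `A`: block sizes `e i`, together with
signs expressing each eigenvalue through `m` parameters, one for each nonzero eigenvalue up to sign.
After conjugation, `B` lies in a linear space `𝒜` attached to the type, and the common centralizer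
`Z` of the matrices in the family does not move the first component. The stratum therefore has
dimension at most `n² - dim Z + m + dim 𝒜`. Here `dim 𝒜` is at most the sum of `min (e i) (e j)`
over pairs with `μ i = -μ j`, and `dim Z` is at least the same sum over pairs with `μ i = μ j`. If
`b_k(z)` counts the blocks of eigenvalue `z` and size greater than `k`, the second sum minus the
first is `½ ∑_k ∑_z (b_k(z) - b_k(-z))²`. The terms with `k = 0` already show that `m` exceeds this
difference by at most `⌊n/2⌋` (`card_upperSpectrum_add_le`).

There are countably many types, so `X` has Hausdorff dimension at most `2(n² + ⌊n/2⌋)`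
(`dimH_anticommuting_le`). Noether normalization turns this into a bound on the Krull dimension
(`varietyDim_le_of_dimH_le`).

Lower bound. Conjugate pairs formed by a diagonal matrix with spectrum symmetric under sign (up to a
free central entry when `n` is odd) and an antidiagonal matrix. This parametrization has derivative
of rank at least `n² + ⌊n/2⌋` at a suitable point, so some linear projection of `X` to a space of
that dimension contains an open set (`le_varietyDim_anticommuting`). -/

/-! ### Krull dimension, integral extensions and transcendence degree -/

theorem ringKrullDim_eq_of_isIntegral_of_injective {A B : Type*} [CommRing A] [CommRing B]
    [Algebra A B] [Algebra.IsIntegral A B] (h : Function.Injective (algebraMap A B)) :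
    ringKrullDim B = ringKrullDim A := by
  have hf : FaithfulSMul A B := (faithfulSMul_iff_algebraMap_injective A B).mpr h
  apply le_antisymm
  · refine Order.krullDim_le_of_strictMono (PrimeSpectrum.comap (algebraMap A B)) ?_
    intro I J hIJ
    exact Ideal.IsIntegral.comap_lt_comap (R := A) (I := I.asIdeal) (J := J.asIdeal) hIJ
  · refine iSup_le fun l => ?_
    obtain ⟨Q, _, hQ, hQ'⟩ := Ideal.exists_ideal_over_prime_of_isIntegral (S := B) l.head.asIdeal ⊥
      (by
        have : Ideal.comap (algebraMap A B) ⊥ = ⊥ := by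
          rw [← RingHom.ker_eq_comap_bot, (RingHom.injective_iff_ker_eq_bot _).mp h]
        rw [this]; exact bot_le)
    have : Q.LiesOver l.head.asIdeal := ⟨hQ'.symm⟩
    obtain ⟨L, hL, -⟩ := Ideal.exists_ltSeries_of_hasGoingUp (S := B) l Q
    rw [← hL]
    exact le_iSup (fun p : LTSeries (PrimeSpectrum B) => (p.length : WithBot ℕ∞)) L

/-- Transcendence degree, after passing to a domain: a prime `q` that avoids the images of all
nonzero polynomials keeps the `N` variables independent in `R ⧸ q`, which is still algebraic over
the subalgebra generated by `d` elements. -/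
theorem card_le_of_injective_of_isIntegral {k R : Type} [Field k] [CommRing R] [Algebra k R]
    {d N : ℕ} (g : MvPolynomial (Fin d) k →ₐ[k] R) (hg : g.IsIntegral)
    (f : MvPolynomial (Fin N) k →ₐ[k] R) (hf : Function.Injective f) : N ≤ d := by
  obtain ⟨q, hq, -, hd⟩ := Ideal.exists_le_prime_disjoint (⊥ : Ideal R)
    ((nonZeroDivisors (MvPolynomial (Fin N) k)).map f) (by
      rw [Set.disjoint_left]
      rintro x hx ⟨y, hy, rfl⟩
      have hx' : f y = f 0 := by simpa using hx
      exact (nonZeroDivisors.ne_zero hy) (hf hx'))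
  let π : R →ₐ[k] R ⧸ q := Ideal.Quotient.mkₐ k q
  have hinj : Function.Injective (π.comp f) := by
    rw [injective_iff_map_eq_zero]
    intro y hy
    by_contra hne
    have h1 : f y ∈ q := by simpa [π, Ideal.Quotient.eq_zero_iff_mem] using hy
    exact Set.disjoint_left.mp hd h1 ⟨y, mem_nonZeroDivisors_of_ne_zero hne, rfl⟩
  have hint : ((π.comp g : MvPolynomial (Fin d) k →ₐ[k] R ⧸ q)).IsIntegral :=
    RingHom.IsIntegral.trans _ _ hg
      (RingHom.isIntegral_of_surjective _ Ideal.Quotient.mk_surjective)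
  let x : Fin d → R ⧸ q := fun i => π (g (MvPolynomial.X i))
  have hrange : Algebra.adjoin k (Set.range x) = (π.comp g).range := by
    rw [Algebra.adjoin_range_eq_range_aeval]
    congr 1
    ext i
    simp [x]
  have halg : Algebra.IsAlgebraic (Algebra.adjoin k (Set.range x)) (R ⧸ q) := by
    have : Algebra.IsIntegral (Algebra.adjoin k (Set.range x)) (R ⧸ q) := by
      constructor
      intro z
      obtain ⟨p, hp, hz⟩ := hint z
      have hmem : ∀ a, (π.comp g) a ∈ Algebra.adjoin k (Set.range x) := by
        intro a
        rw [hrange]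
        exact ⟨a, rfl⟩
      let ρ : MvPolynomial (Fin d) k →+* Algebra.adjoin k (Set.range x) :=
        ((π.comp g).codRestrict _ hmem).toRingHom
      refine ⟨p.map ρ, hp.map _, ?_⟩
      rw [Polynomial.eval₂_map]
      exact hz
    exact Algebra.IsIntegral.isAlgebraic
  have h1 : Algebra.trdeg k (R ⧸ q) ≤ Cardinal.mk (Set.range x) :=
    Algebra.IsAlgebraic.trdeg_le_cardinalMk k (Set.range x)
  have h2 : AlgebraicIndependent k (fun i => (π.comp f) (MvPolynomial.X i)) := by
    rw [AlgebraicIndependent]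
    have : MvPolynomial.aeval (fun i => (π.comp f) (MvPolynomial.X i)) = π.comp f := by
      ext i; simp
    rw [this]
    exact hinj
  have h3 := h2.cardinalMk_le_trdeg
  have h4 : Cardinal.mk (Set.range x) ≤ Cardinal.mk (Fin d) := Cardinal.mk_range_le
  have h5 := (h3.trans h1).trans h4
  simpa using h5

theorem natCast_le_ringKrullDim_of_injective {k R : Type} [Field k] [CommRing R] [Algebra k R]
    [Algebra.FiniteType k R] {N : ℕ}
    (f : MvPolynomial (Fin N) k →ₐ[k] R) (hf : Function.Injective f) :
    (N : WithBot ℕ∞) ≤ ringKrullDim R := by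
  have : Nontrivial R := hf.nontrivial
  obtain ⟨d, g, hg, hint⟩ := exists_integral_inj_algHom_of_fg k R
  have hle := card_le_of_injective_of_isIntegral g hint f hf
  algebraize [g.toRingHom]
  have := ringKrullDim_eq_of_isIntegral_of_injective (A := MvPolynomial (Fin d) k) (B := R) hg
  rw [this, MvPolynomial.ringKrullDim_of_isNoetherianRing, ringKrullDim_eq_zero_of_field]
  simpa using hle

/-! ### Coordinate rings and their characters -/

/-- The restriction of a linear form to `X`, as an element of the coordinate ring. -/
def restrictLinear {V : Type*} [AddCommGroup V] [Module ℂ V] (X : Set V) (φ : V →ₗ[ℂ] ℂ) :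
    coordinateRing X :=
  ⟨fun x => φ x, Algebra.subset_adjoin ⟨φ, fun _ => rfl⟩⟩

section CoordinateRing

variable {V : Type*} [AddCommGroup V] [Module ℂ V] (X : Set V)

theorem finiteType_coordinateRing [FiniteDimensional ℂ V] :
    Algebra.FiniteType ℂ (coordinateRing X) := by
  rw [← Subalgebra.fg_iff_finiteType]
  let b := Module.finBasis ℂ V
  let c : Fin (Module.finrank ℂ V) → X → ℂ := fun i x => b.coord i x
  refine Subalgebra.fg_def.mpr ⟨Set.range c, Set.finite_range c, ?_⟩
  apply le_antisymm
  · refine Algebra.adjoin_mono ?_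
    rintro _ ⟨i, rfl⟩
    exact ⟨b.coord i, fun _ => rfl⟩
  · refine Algebra.adjoin_le ?_
    rintro f ⟨φ, hφ⟩
    have : f = ∑ i, φ (b i) • c i := by
      ext x
      rw [hφ, Finset.sum_apply]
      conv_lhs => rw [← b.sum_repr (x : V), map_sum]
      refine Finset.sum_congr rfl fun i _ => ?_
      simp [c, mul_comm]
    rw [this]
    exact Subalgebra.sum_mem _ fun i _ =>
      Subalgebra.smul_mem _ (Algebra.subset_adjoin (Set.mem_range_self i)) _

variable {X}

/-- A character restricts to a linear functional on the dual of `V`, and finite-dimensional spaces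
are reflexive. -/
theorem exists_eval_of_algHom [FiniteDimensional ℂ V] (χ : coordinateRing X →ₐ[ℂ] ℂ) :
    ∃ v : V, ∀ φ : V →ₗ[ℂ] ℂ, χ (restrictLinear X φ) = φ v := by
  let L : Module.Dual ℂ (Module.Dual ℂ V) :=
    { toFun := fun φ => χ (restrictLinear X φ)
      map_add' := fun φ ψ => by
        rw [← map_add]; rfl
      map_smul' := fun c φ => by
        rw [RingHom.id_apply, ← map_smul]; rfl }
  refine ⟨(Module.evalEquiv ℂ V).symm L, fun φ => ?_⟩
  exact (Module.apply_evalEquiv_symm_apply ℂ V φ L).symm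

theorem algHom_eq_eval (χ : coordinateRing X →ₐ[ℂ] ℂ) (x : X)
    (h : ∀ φ : V →ₗ[ℂ] ℂ, χ (restrictLinear X φ) = φ x) (f : coordinateRing X) :
    χ f = f.1 x := by
  obtain ⟨f, hf⟩ := f
  induction hf using Algebra.adjoin_induction with
  | mem f hf =>
    obtain ⟨φ, hφ⟩ := hf
    have : (⟨f, Algebra.subset_adjoin ⟨φ, hφ⟩⟩ : coordinateRing X) = restrictLinear X φ :=
      Subtype.ext (funext hφ)
    exact (congrArg χ this).trans ((h φ).trans (hφ x).symm)
  | algebraMap r => exact χ.commutes r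
  | add f g hf hg h1 h2 =>
    have := map_add χ (⟨f, hf⟩ : coordinateRing X) ⟨g, hg⟩
    rw [h1, h2] at this
    exact this
  | mul f g hf hg h1 h2 =>
    have := map_mul χ (⟨f, hf⟩ : coordinateRing X) ⟨g, hg⟩
    rw [h1, h2] at this
    exact this

end CoordinateRing

/-! ### Bounding the dimension analytically -/

theorem exists_contDiff_extension {V : Type*} [NormedAddCommGroup V] [NormedSpace ℂ V]
    [FiniteDimensional ℂ V] {X : Set V} (f : coordinateRing X) :
    ∃ F : V → ℂ, ContDiff ℝ 1 F ∧ ∀ x : X, f.1 x = F x := by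
  obtain ⟨f, hf⟩ := f
  induction hf using Algebra.adjoin_induction with
  | mem f hf =>
    obtain ⟨φ, hφ⟩ := hf
    refine ⟨φ, ?_, hφ⟩
    exact ((LinearMap.toContinuousLinearMap φ).restrictScalars ℝ).contDiff
  | algebraMap r => exact ⟨fun _ => r, contDiff_const, fun _ => rfl⟩
  | add f g hf hg h1 h2 =>
    obtain ⟨F, hF, hF'⟩ := h1
    obtain ⟨G, hG, hG'⟩ := h2
    exact ⟨fun v => F v + G v, hF.add hG, fun x => congrArg₂ (· + ·) (hF' x) (hG' x)⟩
  | mul f g hf hg h1 h2 =>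
    obtain ⟨F, hF, hF'⟩ := h1
    obtain ⟨G, hG, hG'⟩ := h2
    exact ⟨fun v => F v * G v, hF.mul hG, fun x => congrArg₂ (· * ·) (hF' x) (hG' x)⟩

theorem dimH_image_le_of_contDiffAt {E F : Type*} [NormedAddCommGroup E] [NormedSpace ℝ E]
    [FiniteDimensional ℝ E] [NormedAddCommGroup F] [NormedSpace ℝ F] {f : E → F} {s : Set E}
    (h : ∀ x ∈ s, ContDiffAt ℝ 1 f x) : dimH (f '' s) ≤ dimH s := by
  refine dimH_image_le_of_locally_lipschitzOn fun x hx => ?_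
  obtain ⟨K, t, ht, hK⟩ := (h x hx).exists_lipschitzOnWith
  exact ⟨K, t, mem_nhdsWithin_of_mem_nhds ht, hK⟩

/-- Every point of affine space lifts along a finite injective homomorphism from a polynomial
ring to a `ℂ`-point. -/
theorem exists_algHom_of_isIntegral {R : Type*} [CommRing R] [Algebra ℂ R]
    {d : ℕ} (g : MvPolynomial (Fin d) ℂ →ₐ[ℂ] R) (hg : Function.Injective g)
    (hint : g.IsIntegral) (c : Fin d → ℂ) :
    ∃ χ : R →ₐ[ℂ] ℂ, ∀ i, χ (g (MvPolynomial.X i)) = c i := by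
  let ev : MvPolynomial (Fin d) ℂ →ₐ[ℂ] ℂ := MvPolynomial.aeval c
  have hev : Function.Surjective ev := fun z => ⟨MvPolynomial.C z, by simp [ev]⟩
  have hmax : (RingHom.ker ev).IsMaximal := RingHom.ker_isMaximal_of_surjective ev hev
  let _ : Algebra (MvPolynomial (Fin d) ℂ) R := g.toRingHom.toAlgebra
  have : Algebra.IsIntegral (MvPolynomial (Fin d) ℂ) R := ⟨hint⟩
  obtain ⟨m, hm, hcm⟩ := Ideal.exists_ideal_over_maximal_of_isIntegral (S := R) (RingHom.ker ev)
    (by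
      have : RingHom.ker (algebraMap (MvPolynomial (Fin d) ℂ) R) = ⊥ :=
        (RingHom.injective_iff_ker_eq_bot _).mp hg
      rw [this]; exact bot_le)
  have hmem : ∀ p, g p ∈ m ↔ ev p = 0 := by
    intro p
    rw [← RingHom.mem_ker, ← hcm]
    rfl
  let _ : Field (R ⧸ m) := Ideal.Quotient.field m
  -- Evaluating the coefficients of an integral equation at `c` gives an integral equation over `ℂ`
  -- in the residue field, so that field is `ℂ` itself.
  have hint' : Algebra.IsIntegral ℂ (R ⧸ m) := by
    constructor
    intro z
    obtain ⟨y, rfl⟩ := Ideal.Quotient.mk_surjective z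
    obtain ⟨p, hp, hy⟩ := hint y
    refine ⟨p.map ev.toRingHom, hp.map _, ?_⟩
    rw [Polynomial.eval₂_map]
    have hcomp : (algebraMap ℂ (R ⧸ m)).comp ev.toRingHom =
        (Ideal.Quotient.mk m).comp g.toRingHom := by
      ext p
      · simp
      · have : g (MvPolynomial.X p - MvPolynomial.C (c p)) ∈ m := by
          rw [hmem]; simp [ev]
        rw [map_sub, ← Ideal.Quotient.eq] at this
        simp only [RingHom.comp_apply]
        refine Eq.trans ?_ this.symm
        have h2 : g (MvPolynomial.C (c p)) = algebraMap ℂ R (c p) := g.commutes (c p)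
        rw [h2]
        simp [ev]
    rw [hcomp, ← Polynomial.hom_eval₂]
    exact (congrArg _ hy).trans (map_zero _)
  have hbij := IsAlgClosed.algebraMap_bijective_of_isIntegral (k := ℂ) (K := R ⧸ m)
  let e : ℂ ≃ₐ[ℂ] (R ⧸ m) := AlgEquiv.ofBijective (Algebra.ofId ℂ (R ⧸ m)) hbij
  refine ⟨e.symm.toAlgHom.comp (Ideal.Quotient.mkₐ ℂ m), fun i => ?_⟩
  have : g (MvPolynomial.X i - MvPolynomial.C (c i)) ∈ m := by
    rw [hmem]; simp [ev]
  rw [map_sub, ← Ideal.Quotient.eq] at this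
  have h2 : g (MvPolynomial.C (c i)) = algebraMap ℂ R (c i) := g.commutes (c i)
  change e.symm (Ideal.Quotient.mk m _) = _
  rw [this, h2, AlgEquiv.symm_apply_eq]
  rfl

/-- Hypothesis `hX` says that every character is a point of `X`. Noether normalization then gives a
surjection from `X` onto `ℂ^d`, with `d` the Krull dimension. It extends to a `C¹` map, which cannot
raise Hausdorff dimension, and `ℂ^d` has Hausdorff dimension `2d`. -/
theorem varietyDim_le_of_dimH_le {V : Type} [NormedAddCommGroup V] [NormedSpace ℂ V]
    [FiniteDimensional ℂ V] {X : Set V} {N : ℕ}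
    (hX : ∀ χ : coordinateRing X →ₐ[ℂ] ℂ, ∃ x : X, ∀ f, χ f = f.1 x) (hne : X.Nonempty)
    (hdim : dimH X ≤ (2 * N : ℕ)) : varietyDim X ≤ N := by
  have : Nonempty X := hne.to_subtype
  have := finiteType_coordinateRing X
  obtain ⟨d, g, hg, hint⟩ := exists_integral_inj_algHom_of_fg ℂ (coordinateRing X)
  have hR : FiniteDimensional ℝ V := FiniteDimensional.complexToReal V
  choose F hF hF' using fun i => exists_contDiff_extension (g (MvPolynomial.X i))
  have hsurj : (fun (v : V) i => F i v) '' X = Set.univ := by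
    refine Set.eq_univ_of_forall fun c => ?_
    obtain ⟨χ, hχ⟩ := exists_algHom_of_isIntegral g hg hint c
    obtain ⟨x, hx⟩ := hX χ
    refine ⟨x, x.2, funext fun i => ?_⟩
    change F i x = c i
    rw [← hF', ← hx, hχ]
  have h1 : dimH (Set.univ : Set (Fin d → ℂ)) ≤ dimH X := by
    rw [← hsurj]
    exact dimH_image_le_of_contDiffAt fun x _ => (contDiff_pi.mpr hF).contDiffAt
  rw [Real.dimH_univ_eq_finrank] at h1
  have h2 : Module.finrank ℝ (Fin d → ℂ) = 2 * d := by
    rw [finrank_real_of_complex]; simp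
  rw [h2] at h1
  have h3 : d ≤ N := by
    have := h1.trans hdim
    have := Nat.cast_le.mp this
    omega
  rw [varietyDim]
  algebraize [g.toRingHom]
  rw [ringKrullDim_eq_of_isIntegral_of_injective (A := MvPolynomial (Fin d) ℂ)
    (B := coordinateRing X) hg, MvPolynomial.ringKrullDim_of_isNoetherianRing,
    ringKrullDim_eq_zero_of_field]
  simpa using h3

/-- A polynomial that vanishes on a polydisc is zero, so the coordinates of `L` are algebraically
independent as functions on `X`. -/
theorem le_varietyDim_of_interior_image_nonempty {V : Type} [AddCommGroup V] [Module ℂ V]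
    [FiniteDimensional ℂ V] {X : Set V} {N : ℕ} (L : V →ₗ[ℂ] (Fin N → ℂ))
    (h : (interior (L '' X)).Nonempty) : (N : WithBot ℕ∞) ≤ varietyDim X := by
  have := finiteType_coordinateRing X
  let f : MvPolynomial (Fin N) ℂ →ₐ[ℂ] coordinateRing X :=
    MvPolynomial.aeval fun i => restrictLinear X (LinearMap.proj i ∘ₗ L)
  refine natCast_le_ringKrullDim_of_injective f ?_
  rw [injective_iff_map_eq_zero]
  intro p hp
  obtain ⟨y, hy⟩ := h
  obtain ⟨ε, hε, hball⟩ := Metric.isOpen_iff.mp isOpen_interior y hy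
  refine MvPolynomial.funext_set (fun i => Metric.ball (y i) ε) (fun i => ?_) fun z hz => ?_
  · exact infinite_of_mem_nhds (y i) (Metric.ball_mem_nhds _ hε)
  · rw [← ball_pi _ hε] at hz
    obtain ⟨x, hx, rfl⟩ := interior_subset (hball hz)
    have key : ∀ q, (f q).1 ⟨x, hx⟩ = MvPolynomial.eval (L x) q := by
      intro q
      let evx : coordinateRing X →ₐ[ℂ] ℂ :=
        (Pi.evalAlgHom ℂ (fun _ : X => ℂ) ⟨x, hx⟩).comp (coordinateRing X).val
      have : evx.comp f = MvPolynomial.aeval (L x) := by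
        ext i
        simp [evx, f]
        rfl
      exact DFunLike.congr_fun this q
    rw [← key, hp]
    simp

/-! ### Hausdorff dimension of a family of conjugates -/

section OrbitDimension

variable {𝔸 : Type*} [NormedRing 𝔸] [NormedAlgebra ℂ 𝔸] [FiniteDimensional ℂ 𝔸]

/-- A linear slice, near the unit `g`, for right multiplication by the units in a subspace `Z`. -/
theorem exists_linear_slice (Z : Submodule ℂ 𝔸) (h1 : (1 : 𝔸) ∈ Z) (g : 𝔸ˣ) :
    ∃ W : Submodule ℂ 𝔸, Module.finrank ℂ W + Module.finrank ℂ Z = Module.finrank ℂ 𝔸 ∧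
      ∀ᶠ x in nhds (g : 𝔸), ∃ w ∈ W, ∃ h ∈ Z, IsUnit h ∧ x = (g + w) * h := by
  have hc : CompleteSpace 𝔸 := FiniteDimensional.complete ℂ 𝔸
  let μ : 𝔸 →ₗ[ℂ] 𝔸 := LinearMap.mulLeft ℂ (g : 𝔸)
  have hμ : Function.Injective μ := fun a b hab => by simpa [μ] using hab
  obtain ⟨W, hW⟩ := Submodule.exists_isCompl (Z.map μ)
  refine ⟨W, ?_, ?_⟩
  · rw [← Submodule.finrank_add_eq_of_isCompl hW, add_comm,
      (Submodule.equivMapOfInjective μ hμ Z).finrank_eq]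
  have hcW : CompleteSpace W := FiniteDimensional.complete ℂ W
  have hcZ : CompleteSpace Z := FiniteDimensional.complete ℂ Z
  let f : W × Z → 𝔸 := fun p => (g + p.1) * p.2
  have hd : HasStrictFDerivAt f _ ((0, ⟨1, h1⟩) : W × Z) :=
    ((((W.subtypeL.comp (ContinuousLinearMap.fst ℂ W Z)).hasStrictFDerivAt
      (x := (0, ⟨1, h1⟩))).const_add (g : 𝔸)).mul'
        ((Z.subtypeL.comp (ContinuousLinearMap.snd ℂ W Z)).hasStrictFDerivAt
          (x := (0, ⟨1, h1⟩))))
  -- At `(0, 1)` the derivative is `(w, z) ↦ w + g z`, which is onto because `W` complements `g Z`;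
  -- hence `f` is open there.
  have hmap := hd.map_nhds_eq_of_surj (by
    rw [LinearMap.range_eq_top]
    intro y
    have hy : y ∈ Z.map μ ⊔ W := by rw [hW.sup_eq_top]; trivial
    obtain ⟨_, ⟨z, hz, rfl⟩, w, hw, rfl⟩ := Submodule.mem_sup.mp hy
    exact ⟨(⟨w, hw⟩, ⟨z, hz⟩), by simp [μ]⟩)
  have hf0 : f (0, ⟨1, h1⟩) = g := by simp [f]
  rw [hf0] at hmap
  have hU : {p : W × Z | IsUnit (p.2 : 𝔸)} ∈ nhds ((0, ⟨1, h1⟩) : W × Z) := by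
    have hopen : IsOpen {p : W × Z | IsUnit (p.2 : 𝔸)} :=
      Units.isOpen.preimage (continuous_subtype_val.comp continuous_snd)
    exact hopen.mem_nhds isUnit_one
  rw [← hmap]
  filter_upwards [Filter.image_mem_map hU] with x hx
  obtain ⟨⟨w, h⟩, hp, rfl⟩ := hx
  exact ⟨w, w.2, h, h.2, hp, rfl⟩

/-- Near a unit `g`, write `u = (g + w) h` with `w` in the slice and `h ∈ Z`. The factor `h` fixes
`φ t` and is absorbed into `a`, so only `w`, `t` and `a` remain, and the slice has dimension `dim 𝔸
- dim Z`. -/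
theorem dimH_conj_family_le (Z A : Submodule ℂ 𝔸) (h1 : (1 : 𝔸) ∈ Z) {m N : ℕ}
    {φ : (Fin m → ℂ) → 𝔸} (hφ : ContDiff ℝ 1 φ) (hcomm : ∀ t, ∀ h ∈ Z, Commute h (φ t))
    (hA : ∀ u : 𝔸ˣ, (u : 𝔸) ∈ Z → ∀ a ∈ A, (u : 𝔸) * a * (u⁻¹ : 𝔸ˣ) ∈ A)
    (hN : Module.finrank ℂ 𝔸 + m + Module.finrank ℂ A ≤ N + Module.finrank ℂ Z) :
    dimH {p : 𝔸 × 𝔸 | ∃ u : 𝔸ˣ, ∃ t, ∃ a ∈ A,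
      p = ((u : 𝔸) * φ t * (u⁻¹ : 𝔸ˣ), (u : 𝔸) * a * (u⁻¹ : 𝔸ˣ))} ≤ (2 * N : ℕ) := by
  have hc : CompleteSpace 𝔸 := FiniteDimensional.complete ℂ 𝔸
  have hp : ProperSpace 𝔸 := FiniteDimensional.proper ℂ 𝔸
  choose W hW hnear using exists_linear_slice Z h1
  let Ω : Set 𝔸 := {x | IsUnit x}
  let U : 𝔸 → Set 𝔸 := fun x => {y | ∀ h : IsUnit x, ∃ w ∈ W h.unit, ∃ z ∈ Z, IsUnit z ∧
    y = (x + w) * z}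
  have hU : ∀ x ∈ Ω, U x ∈ nhdsWithin x Ω := by
    intro x hx
    refine mem_nhdsWithin_of_mem_nhds ?_
    filter_upwards [hnear (IsUnit.unit hx)] with y hy _
    exact hy
  -- By Lindelöf, countably many slices suffice, and Hausdorff dimension is stable under countable
  -- unions.
  obtain ⟨s, hsΩ, hs, hcov⟩ := TopologicalSpace.countable_cover_nhdsWithin hU
  let ψ : (g : 𝔸ˣ) → W g × (Fin m → ℂ) × A → 𝔸 × 𝔸 := fun g q =>
    ((g + q.1) * φ q.2.1 * Ring.inverse (g + q.1 : 𝔸), (g + q.1) * q.2.2 * Ring.inverse (g + q.1 : 𝔸))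
  let D : (g : 𝔸ˣ) → Set (W g × (Fin m → ℂ) × A) := fun g => {q | IsUnit (g + q.1 : 𝔸)}
  have hdim : ∀ g : 𝔸ˣ, dimH (ψ g '' D g) ≤ (2 * N : ℕ) := by
    intro g
    have f1 : FiniteDimensional ℝ (W g) := FiniteDimensional.complexToReal _
    have f2 : FiniteDimensional ℝ A := FiniteDimensional.complexToReal _
    have e1 : dimH (ψ g '' D g) ≤ dimH (D g) := by
      refine dimH_image_le_of_contDiffAt fun q hq => ?_
      have c1 : ContDiff ℝ 1 fun q : W g × (Fin m → ℂ) × A => (g + q.1 : 𝔸) :=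
        contDiff_const.add (((W g).subtypeL.restrictScalars ℝ).contDiff.comp contDiff_fst)
      have c2 : ContDiff ℝ 1 fun q : W g × (Fin m → ℂ) × A => φ q.2.1 :=
        hφ.comp (contDiff_fst.comp contDiff_snd)
      have c3 : ContDiff ℝ 1 fun q : W g × (Fin m → ℂ) × A => (q.2.2 : 𝔸) :=
        (A.subtypeL.restrictScalars ℝ).contDiff.comp (contDiff_snd.comp contDiff_snd)
      have c4 : ContDiffAt ℝ 1 (fun q : W g × (Fin m → ℂ) × A => Ring.inverse (g + q.1 : 𝔸)) q := by
        have := contDiffAt_ringInverse ℝ (n := 1) (R := 𝔸) (IsUnit.unit hq)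
        exact ContDiffAt.comp q this c1.contDiffAt
      exact ((c1.mul c2).contDiffAt.mul c4).prodMk ((c1.mul c3).contDiffAt.mul c4)
    refine e1.trans ((dimH_mono (Set.subset_univ _)).trans ?_)
    rw [Real.dimH_univ_eq_finrank, Nat.cast_le, Module.finrank_prod, Module.finrank_prod,
      finrank_real_of_complex, finrank_real_of_complex, finrank_real_of_complex]
    have := hW g
    simp only [Module.finrank_fin_fun]
    omega
  have hsub : {p : 𝔸 × 𝔸 | ∃ u : 𝔸ˣ, ∃ t, ∃ a ∈ A,
      p = ((u : 𝔸) * φ t * (u⁻¹ : 𝔸ˣ), (u : 𝔸) * a * (u⁻¹ : 𝔸ˣ))} ⊆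
      ⋃ x ∈ s, {p | ∃ h : IsUnit x, p ∈ ψ h.unit '' D h.unit} := by
    rintro _ ⟨u, t, a, ha, rfl⟩
    obtain ⟨x, hx, hux⟩ := Set.mem_iUnion₂.mp (hcov (show (u : 𝔸) ∈ Ω from u.isUnit))
    refine Set.mem_iUnion₂.mpr ⟨x, hx, hsΩ hx, ?_⟩
    obtain ⟨w, hw, z, hz, ⟨z, rfl⟩, huz⟩ := hux (hsΩ hx)
    have hv : x + w = ((u * z⁻¹ : 𝔸ˣ) : 𝔸) := by
      rw [Units.val_mul, huz, mul_assoc, Units.mul_inv, mul_one]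
    have hu : u = (u * z⁻¹) * z := by simp
    refine ⟨(⟨w, hw⟩, t, ⟨z * a * (z⁻¹ : 𝔸ˣ), hA z hz a ha⟩), ?_, ?_⟩
    · change IsUnit (x + w)
      rw [hv]; exact Units.isUnit _
    · change ((x + w) * φ t * Ring.inverse (x + w),
        (x + w) * (z * a * (z⁻¹ : 𝔸ˣ)) * Ring.inverse (x + w)) = _
      rw [hv, Ring.inverse_unit]
      have hzt := (hcomm t z hz).eq
      refine Prod.ext ?_ ?_
      · change _ = (u : 𝔸) * φ t * (u⁻¹ : 𝔸ˣ)
        have h3 : ((z⁻¹ : 𝔸ˣ) : 𝔸) * φ t * z = φ t := by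
          rw [mul_assoc, ← hzt, ← mul_assoc, Units.inv_mul, one_mul]
        simp only [mul_inv_rev, inv_inv, Units.val_mul]
        calc (u : 𝔸) * (z⁻¹ : 𝔸ˣ) * φ t * (z * (u⁻¹ : 𝔸ˣ))
            = u * ((z⁻¹ : 𝔸ˣ) * φ t * z) * (u⁻¹ : 𝔸ˣ) := by simp only [mul_assoc]
          _ = _ := by rw [h3]
      · simp [mul_assoc]
  refine (dimH_mono hsub).trans ?_
  rw [dimH_bUnion hs]
  refine iSup₂_le fun x hx => ?_
  refine (dimH_mono (t := ψ (IsUnit.unit (hsΩ hx)) '' D _) ?_).trans (hdim _)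
  rintro p ⟨_, hp⟩
  exact hp

end OrbitDimension

/-! ### Jordan normal form -/

/-- The Jordan matrix with blocks of sizes `e i` and eigenvalues `μ i`. -/
noncomputable def jordanMatrix {ι : Type*} [DecidableEq ι] (e : ι → ℕ) (μ : ι → ℂ) :
    Matrix (Σ i, Fin (e i)) (Σ i, Fin (e i)) ℂ :=
  Matrix.of fun p q =>
    (if p = q then μ p.1 else 0) + if p.1 = q.1 ∧ (p.2 : ℕ) = q.2 + 1 then 1 else 0

theorem jordanMatrix_mulVec {ι : Type*} [Fintype ι] [DecidableEq ι] (e : ι → ℕ) (μ : ι → ℂ)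
    (v : (Σ i, Fin (e i)) → ℂ) (i : ι) (k : Fin (e i)) :
    (jordanMatrix e μ).mulVec v ⟨i, k⟩ =
      μ i * v ⟨i, k⟩ + ∑ l : Fin (e i), if (k : ℕ) = l + 1 then v ⟨i, l⟩ else 0 := by
  simp only [Matrix.mulVec, dotProduct, jordanMatrix, Matrix.of_apply, add_mul,
    Finset.sum_add_distrib]
  congr 1
  · rw [Finset.sum_eq_single ⟨i, k⟩] <;> simp +contextual [eq_comm]
  · rw [Fintype.sum_sigma, Finset.sum_eq_single i]
    · simp
    · intro j _ hj
      simp [hj.symm]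
    · simp

open Polynomial in
-- Since `p` is associated to `X - a`, the Taylor coefficients at `a` of order below `e` are
-- coordinates on the quotient. Multiplication by `X = a + (X - a)` becomes `a` plus a shift.
theorem exists_equiv_quotient_span_pow {p : ℂ[X]} (hp : Irreducible p) (e : ℕ) :
    ∃ (a : ℂ) (T : (ℂ[X] ⧸ (Submodule.span ℂ[X] {p ^ e})) ≃ₗ[ℂ] (Fin e → ℂ)),
      ∀ z (k : Fin e), T ((X : ℂ[X]) • z) k =
        a * T z k + ∑ l : Fin e, if (k : ℕ) = l + 1 then T z l else 0 := by
  have hdeg := IsAlgClosed.degree_eq_one_of_irreducible ℂ hp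
  obtain ⟨a, ha⟩ := Polynomial.exists_root_of_degree_eq_one hdeg
  have hass : Associated (X - C a) p :=
    (Polynomial.irreducible_X_sub_C a).associated_of_dvd hp (Polynomial.dvd_iff_isRoot.mpr ha)
  let τ : ℂ[X] →ₗ[ℂ] (Fin e → ℂ) := LinearMap.pi fun k => lcoeff ℂ k ∘ₗ taylor a
  have hτ : ∀ f k, τ f k = (taylor a f).coeff k := fun f k => rfl
  have hdvd : ∀ f, (X - C a) ^ e ∣ f ↔ X ^ e ∣ taylor a f := by
    intro f
    have h1 : taylorEquiv a ((X - C a) ^ e) = X ^ e := by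
      rw [map_pow, map_sub]
      congr 1
      change taylor a X - taylor a (C a) = X
      simp
    rw [← map_dvd_iff (taylorEquiv a), h1]
    rfl
  have hker : τ.ker = (Submodule.span ℂ[X] {p ^ e}).restrictScalars ℂ := by
    ext f
    rw [LinearMap.mem_ker, Submodule.restrictScalars_mem, ← Ideal.span,
      Ideal.mem_span_singleton, ← (hass.pow_pow (n := e)).dvd_iff_dvd_left, hdvd, X_pow_dvd_iff]
    constructor
    · intro h d hd
      exact congrFun h ⟨d, hd⟩
    · intro h
      ext k
      exact h k k.2
  have hsurj : Function.Surjective τ := by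
    intro v
    refine ⟨(taylorEquiv a).symm (∑ k : Fin e, C (v k) * X ^ (k : ℕ)), ?_⟩
    ext k
    rw [hτ]
    change (taylorEquiv a ((taylorEquiv a).symm _)).coeff _ = _
    rw [AlgEquiv.apply_symm_apply, finsetSum_coeff, Finset.sum_eq_single k]
    · simp
    · intro l _ hl
      rw [coeff_C_mul_X_pow, if_neg]
      exact fun h => hl (Fin.ext h.symm)
    · simp
  let T := (Submodule.Quotient.restrictScalarsEquiv ℂ (Submodule.span ℂ[X] {p ^ e})).symm.trans
    ((Submodule.quotEquivOfEq _ _ hker.symm).trans (τ.quotKerEquivOfSurjective hsurj))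
  have hT : ∀ f : ℂ[X], T (Submodule.Quotient.mk f) = τ f := fun f => rfl
  refine ⟨a, T, fun z k => ?_⟩
  obtain ⟨f, rfl⟩ := Submodule.Quotient.mk_surjective _ z
  rw [← Submodule.Quotient.mk_smul, hT, hT, hτ, smul_eq_mul, taylor_mul, taylor_X, add_mul,
    coeff_add, add_comm, coeff_C_mul]
  congr 1
  obtain ⟨k, hk⟩ := k
  cases k with
  | zero => simp
  | succ k =>
    rw [coeff_X_mul, Finset.sum_eq_single ⟨k, by omega⟩]
    · simp [hτ]
    · intro l _ hl
      rw [if_neg]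
      intro h
      exact hl (Fin.ext (by simpa using h.symm))
    · simp

/-- Structure theorem for the torsion `ℂ[X]`-module on which `X` acts by `A`. -/
theorem exists_jordan_linearEquiv {n : ℕ} (A : Matrix (Fin n) (Fin n) ℂ) :
    ∃ (ι : Type) (_ : Fintype ι) (_ : DecidableEq ι) (e : ι → ℕ) (μ : ι → ℂ)
      (E : (Fin n → ℂ) ≃ₗ[ℂ] ((Σ i, Fin (e i)) → ℂ)),
      ∀ v, E (A.mulVec v) = (jordanMatrix e μ).mulVec (E v) := by
  classical
  let φ : (Fin n → ℂ) →ₗ[ℂ] (Fin n → ℂ) := Matrix.toLin' A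
  have htor : Module.IsTorsion (Polynomial ℂ) (Module.AEval' φ) :=
    Module.AEval.isTorsion_of_finiteDimensional ℂ (Fin n → ℂ) φ
  obtain ⟨ι, hι, p, hp, e, ⟨D⟩⟩ := Module.equiv_directSum_of_isTorsion htor
  choose a T hT using fun i => exists_equiv_quotient_span_pow (hp i) (e i)
  let D' := D.trans (DirectSum.linearEquivFunOnFintype (Polynomial ℂ) ι _)
  let E : (Fin n → ℂ) ≃ₗ[ℂ] ((Σ i, Fin (e i)) → ℂ) :=
    (Module.AEval'.of φ).trans ((D'.restrictScalars ℂ).trans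
      ((LinearEquiv.piCongrRight T).trans (LinearEquiv.piCurry ℂ fun i (_ : Fin (e i)) => ℂ).symm))
  have hE : ∀ v i k, E v ⟨i, k⟩ = T i (D' (Module.AEval'.of φ v) i) k := fun v i k => rfl
  refine ⟨ι, hι, inferInstance, e, a, E, fun v => ?_⟩
  ext ⟨i, k⟩
  rw [jordanMatrix_mulVec]
  have h1 : Module.AEval'.of φ (A.mulVec v) =
      (Polynomial.X : Polynomial ℂ) • Module.AEval'.of φ v := by
    rw [Module.AEval'.X_smul_of]; rfl
  simp only [hE]
  rw [h1, map_smul, Pi.smul_apply, hT]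

theorem exists_jordan_normal_form {n : ℕ} (A : Matrix (Fin n) (Fin n) ℂ) :
    ∃ (r : ℕ) (e : Fin r → ℕ) (μ : Fin r → ℂ) (f : (Σ i, Fin (e i)) ≃ Fin n)
      (u : (Matrix (Fin n) (Fin n) ℂ)ˣ), (∀ i, 0 < e i) ∧
      A = u * Matrix.reindexAlgEquiv ℂ ℂ f (jordanMatrix e μ) *
        (u⁻¹ : (Matrix (Fin n) (Fin n) ℂ)ˣ) := by
  obtain ⟨ι, _, _, e, μ, E, hE⟩ := exists_jordan_linearEquiv A
  -- The structure theorem may produce exponents `0`. These empty blocks are dropped, because the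
  -- later count needs each listed eigenvalue to have an actual block.
  let g : Fin (Fintype.card {i // 0 < e i}) ≃ {i // 0 < e i} := (Fintype.equivFin _).symm
  let h : (Σ j, Fin (e (g j))) ≃ Σ i, Fin (e i) :=
    { toFun := fun x => ⟨g x.1, x.2⟩
      invFun := fun x => ⟨g.symm ⟨x.1, x.2.pos⟩, Fin.cast (by simp) x.2⟩
      left_inv := by
        rintro ⟨j, k⟩
        refine Sigma.ext (by simp) ?_
        rw [Fin.heq_ext_iff] <;> simp
      right_inv := by
        rintro ⟨i, k⟩
        refine Sigma.ext (by simp) ?_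
        rw [Fin.heq_ext_iff] <;> simp }
  have hJ : ∀ p q, jordanMatrix (fun j => e (g j)) (fun j => μ (g j)) p q =
      jordanMatrix e μ (h p) (h q) := by
    rintro ⟨i, k⟩ ⟨j, l⟩
    have h1 : ((⟨i, k⟩ : Σ j, Fin (e (g j))) = ⟨j, l⟩) ↔ h ⟨i, k⟩ = h ⟨j, l⟩ :=
      h.injective.eq_iff.symm
    have h2 : i = j ↔ (g i : ι) = g j := by
      rw [Subtype.val_injective.eq_iff, g.injective.eq_iff]
    simp only [jordanMatrix, Matrix.of_apply, h1, h2]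
    rfl
  have hcard : Fintype.card (Σ i, Fin (e i)) = Fintype.card (Fin n) := by
    have := E.finrank_eq
    rw [Module.finrank_fintype_fun_eq_card, Module.finrank_fintype_fun_eq_card] at this
    exact this.symm
  let f₀ : (Σ i, Fin (e i)) ≃ Fin n := Fintype.equivOfCardEq hcard
  let E' : (Fin n → ℂ) ≃ₗ[ℂ] (Fin n → ℂ) := E.trans (LinearEquiv.funCongrLeft ℂ ℂ f₀.symm)
  let B := Matrix.reindexAlgEquiv ℂ ℂ (h.trans f₀)
    (jordanMatrix (fun j => e (g j)) fun j => μ (g j))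
  have hB : ∀ v, E' (A.mulVec v) = B.mulVec (E' v) := by
    intro v
    ext i
    change E (A.mulVec v) (f₀.symm i) = _
    rw [hE]
    simp only [Matrix.mulVec, dotProduct]
    rw [← f₀.sum_comp]
    refine Finset.sum_congr rfl fun q _ => ?_
    have h1 : B i (f₀ q) = jordanMatrix e μ (f₀.symm i) q := by
      have h2 : B i (f₀ q) = jordanMatrix (fun j => e (g j)) (fun j => μ (g j))
        (h.symm (f₀.symm i)) (h.symm (f₀.symm (f₀ q))) := rfl
      rw [h2, hJ, Equiv.apply_symm_apply, Equiv.apply_symm_apply, Equiv.symm_apply_apply]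
    have h3 : E' v (f₀ q) = E v (f₀.symm (f₀ q)) := rfl
    rw [h1, h3, Equiv.symm_apply_apply]
  let U : (Matrix (Fin n) (Fin n) ℂ)ˣ :=
    ⟨LinearMap.toMatrix' E'.toLinearMap, LinearMap.toMatrix' E'.symm.toLinearMap,
      by rw [← LinearMap.toMatrix'_comp]; simp, by rw [← LinearMap.toMatrix'_comp]; simp⟩
  have hU : (U : Matrix (Fin n) (Fin n) ℂ) * A = B * U := by
    apply Matrix.toLin'.injective
    rw [Matrix.toLin'_mul, Matrix.toLin'_mul]
    have h1 : Matrix.toLin' (U : Matrix (Fin n) (Fin n) ℂ) = E'.toLinearMap :=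
      Matrix.toLin'_toMatrix' _
    rw [h1]
    exact LinearMap.ext hB
  refine ⟨_, _, fun j => μ (g j), h.trans f₀, U⁻¹, fun j => (g j).2, ?_⟩
  change A = _ * B * _
  rw [inv_inv, mul_assoc, ← hU, ← mul_assoc, Units.inv_mul, one_mul]

/-! ### Centralizers and anticommuting spaces of Jordan matrices -/

section TwistedCentralizer

variable {𝔸 : Type*} [Ring 𝔸] [Algebra ℂ 𝔸] {m : ℕ}

/-- The elements `y` with `x y = c y x` for all `x` in a given finite family: the centralizer for
`c = 1`, the space of anticommuting elements for `c = -1`. -/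
def twistedCentralizer (c : ℂ) (D : Fin m → 𝔸) (N : 𝔸) : Submodule ℂ 𝔸 where
  carrier := {y | (∀ a, D a * y = c • (y * D a)) ∧ N * y = c • (y * N)}
  add_mem' := by
    rintro x y ⟨hx, hx'⟩ ⟨hy, hy'⟩
    exact ⟨fun a => by rw [mul_add, hx, hy, add_mul, smul_add],
      by rw [mul_add, hx', hy', add_mul, smul_add]⟩
  zero_mem' := by simp
  smul_mem' := by
    rintro b y ⟨hy, hy'⟩
    exact ⟨fun a => by rw [mul_smul_comm, hy, smul_mul_assoc, smul_comm],
      by rw [mul_smul_comm, hy', smul_mul_assoc, smul_comm]⟩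

theorem mem_twistedCentralizer {c : ℂ} {D : Fin m → 𝔸} {N y : 𝔸} :
    y ∈ twistedCentralizer c D N ↔
      (∀ a, D a * y = c • (y * D a)) ∧ N * y = c • (y * N) := Iff.rfl

theorem finrank_twistedCentralizer_map {𝔹 : Type*} [Ring 𝔹] [Algebra ℂ 𝔹] (ρ : 𝔸 ≃ₐ[ℂ] 𝔹)
    (c : ℂ) (D : Fin m → 𝔸) (N : 𝔸) :
    Module.finrank ℂ (twistedCentralizer c (fun a => ρ (D a)) (ρ N)) =
      Module.finrank ℂ (twistedCentralizer c D N) := by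
  have : twistedCentralizer c (fun a => ρ (D a)) (ρ N) =
      (twistedCentralizer c D N).map ρ.toLinearEquiv.toLinearMap := by
    ext y
    obtain ⟨x, rfl⟩ := ρ.surjective y
    have h : ρ x ∈ (twistedCentralizer c D N).map ρ.toLinearEquiv.toLinearMap ↔
        x ∈ twistedCentralizer c D N :=
      ⟨fun ⟨_, hx, h⟩ => ρ.injective h ▸ hx, fun h => ⟨x, h, rfl⟩⟩
    rw [h]
    simp only [mem_twistedCentralizer, ← map_mul, ← map_smul, ρ.injective.eq_iff]
  rw [this]
  exact (ρ.toLinearEquiv.submoduleMap _).finrank_eq.symm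

theorem conj_mem_twistedCentralizer {c : ℂ} {D : Fin m → 𝔸} {N : 𝔸} (u : 𝔸ˣ)
    (hu : (u : 𝔸) ∈ twistedCentralizer 1 D N) {y : 𝔸} (hy : y ∈ twistedCentralizer c D N) :
    (u : 𝔸) * y * (u⁻¹ : 𝔸ˣ) ∈ twistedCentralizer c D N := by
  have key : ∀ x : 𝔸, x * u = (1 : ℂ) • (u * x) → x * y = c • (y * x) →
      x * ((u : 𝔸) * y * (u⁻¹ : 𝔸ˣ)) = c • ((u : 𝔸) * y * (u⁻¹ : 𝔸ˣ) * x) := by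
    intro x hx hxy
    rw [one_smul] at hx
    have hx' : x * (u⁻¹ : 𝔸ˣ) = (u⁻¹ : 𝔸ˣ) * x := by
      have : Commute x u := hx
      exact this.units_inv_right.eq
    calc x * ((u : 𝔸) * y * (u⁻¹ : 𝔸ˣ)) = x * u * y * (u⁻¹ : 𝔸ˣ) := by simp only [mul_assoc]
      _ = u * (x * y) * (u⁻¹ : 𝔸ˣ) := by rw [hx]; simp only [mul_assoc]
      _ = c • (u * y * (x * (u⁻¹ : 𝔸ˣ))) := by
        rw [hxy, mul_smul_comm, smul_mul_assoc]; simp only [mul_assoc]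
      _ = _ := by rw [hx']; simp only [mul_assoc]
  exact ⟨fun a => key _ (hu.1 a) (hy.1 a), key _ hu.2 hy.2⟩

end TwistedCentralizer

theorem dimH_conj_twistedCentralizer_le {𝔸 : Type*} [NormedRing 𝔸] [NormedAlgebra ℂ 𝔸]
    [FiniteDimensional ℂ 𝔸] {m N : ℕ} (c : ℂ) (D : Fin m → 𝔸) (E : 𝔸)
    (hN : Module.finrank ℂ 𝔸 + m + Module.finrank ℂ (twistedCentralizer c D E) ≤
      N + Module.finrank ℂ (twistedCentralizer 1 D E)) :
    dimH {p : 𝔸 × 𝔸 | ∃ u : 𝔸ˣ, ∃ t : Fin m → ℂ, ∃ y ∈ twistedCentralizer c D E,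
      p = ((u : 𝔸) * (E + ∑ a, t a • D a) * (u⁻¹ : 𝔸ˣ), (u : 𝔸) * y * (u⁻¹ : 𝔸ˣ))} ≤
      (2 * N : ℕ) := by
  refine dimH_conj_family_le (twistedCentralizer 1 D E) (twistedCentralizer c D E)
    (φ := fun t => E + ∑ a, t a • D a) ?_ ?_ ?_ ?_ hN
  · simp [mem_twistedCentralizer]
  · refine contDiff_const.add (ContDiff.sum fun a _ => ?_)
    exact (contDiff_apply ℝ ℂ a).smul contDiff_const
  · intro t h hh
    refine Commute.add_right ?_ (Commute.sum_right _ _ _ fun a _ => Commute.smul_right ?_ _)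
    · exact (by simpa using hh.2 : E * h = h * E).symm
    · exact (by simpa using hh.1 a : D a * h = h * D a).symm
  · exact fun u hu y hy => conj_mem_twistedCentralizer u hu hy

theorem jordanMatrix_eq_add {ι : Type*} [DecidableEq ι] {e : ι → ℕ} {m : ℕ} (μ : ι → ℂ) (S : ι → Fin m → ℂ) (t : Fin m → ℂ)
    (h : ∀ i, μ i = ∑ a, t a * S i a) :
    jordanMatrix e μ = jordanMatrix e 0 +
      ∑ a, t a • Matrix.diagonal fun p : Σ i, Fin (e i) => S p.1 a := by
  ext p q
  rw [Matrix.add_apply, Matrix.sum_apply]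
  by_cases hpq : p = q
  · subst hpq
    simp [jordanMatrix, h, add_comm]
  · simp [jordanMatrix, hpq]

/-- The data determining an element of the twisted centralizer. -/
abbrev CentralizerCoord {ι : Type*} (e : ι → ℕ) (R : ι → ι → Prop) : Type _ :=
  (Σ x : {x : ι × ι // R x.1 x.2}, Fin (min (e x.1.1) (e x.1.2)))

theorem finrank_centralizerCoord {ι : Type*} [Fintype ι] {e : ι → ℕ} (R : ι → ι → Prop) [DecidableRel R] :
    Module.finrank ℂ (CentralizerCoord e R → ℂ) =
      ∑ i, ∑ j, if R i j then min (e i) (e j) else 0 := by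
  rw [Module.finrank_fintype_fun_eq_card, Fintype.card_sigma]
  simp only [Fintype.card_fin]
  rw [← Finset.sum_subtype (Finset.univ.filter fun x : ι × ι => R x.1 x.2) (by simp)
    (fun x => min (e x.1) (e x.2)), Finset.sum_filter, Fintype.sum_prod_type]

section JordanCentralizer

variable {ι : Type*} [Fintype ι] [DecidableEq ι] {e : ι → ℕ}

theorem jordanMatrix_zero_mul_apply (Y : Matrix (Σ i, Fin (e i)) (Σ i, Fin (e i)) ℂ) (i : ι)
    (k : Fin (e i)) (q : Σ i, Fin (e i)) :
    (jordanMatrix e 0 * Y) ⟨i, k⟩ q =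
      if h : 0 < (k : ℕ) then Y ⟨i, ⟨k - 1, by omega⟩⟩ q else 0 := by
  have h1 : (jordanMatrix e 0 * Y) ⟨i, k⟩ q = (jordanMatrix e 0).mulVec (fun p => Y p q) ⟨i, k⟩ :=
    rfl
  rw [h1, jordanMatrix_mulVec]
  simp only [Pi.zero_apply, zero_mul, zero_add]
  split_ifs with h
  · rw [Finset.sum_eq_single ⟨k - 1, by omega⟩]
    · rw [if_pos]; simp; omega
    · intro l _ hl
      rw [if_neg]
      intro h'
      exact hl (Fin.ext (by simp; omega))
    · simp
  · exact Finset.sum_eq_zero fun l _ => if_neg (by omega)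

theorem mul_jordanMatrix_zero_apply (Y : Matrix (Σ i, Fin (e i)) (Σ i, Fin (e i)) ℂ)
    (p : Σ i, Fin (e i)) (j : ι) (l : Fin (e j)) :
    (Y * jordanMatrix e 0) p ⟨j, l⟩ =
      if h : (l : ℕ) + 1 < e j then Y p ⟨j, ⟨l + 1, h⟩⟩ else 0 := by
  rw [Matrix.mul_apply, Fintype.sum_sigma, Finset.sum_eq_single j]
  · simp only [jordanMatrix, Matrix.of_apply, Pi.zero_apply, ite_self, zero_add, true_and]
    split_ifs with h
    · rw [Finset.sum_eq_single ⟨l + 1, h⟩]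
      · simp
      · intro k _ hk
        rw [if_neg, mul_zero]
        intro h'
        exact hk (Fin.ext h')
      · simp
    · refine Finset.sum_eq_zero fun k _ => ?_
      rw [if_neg, mul_zero]
      omega
  · intro i _ hi
    refine Finset.sum_eq_zero fun k _ => ?_
    simp [jordanMatrix, hi]
  · simp

/-- The diagonal relations kill every block outside `R`. The nilpotent relation reads `Y (k-1, l) =
c Y (k, l+1)`, so each remaining block is determined by its first column, where only the bottom `min
(e i) (e j)` entries can be nonzero; `F` reads these off. -/
theorem finrank_twistedCentralizer_jordanMatrix_le {m : ℕ} (S : ι → Fin m → ℂ) {c : ℂ} (hc : c ≠ 0)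
    (R : ι → ι → Prop) [DecidableRel R] (hR : ∀ i j, (∀ a, S i a = c * S j a) → R i j) :
    Module.finrank ℂ (twistedCentralizer c
      (fun a => Matrix.diagonal fun p : Σ i, Fin (e i) => S p.1 a) (jordanMatrix e 0)) ≤
      ∑ i, ∑ j, if R i j then min (e i) (e j) else 0 := by
  rw [← finrank_centralizerCoord]
  let F : Matrix (Σ i, Fin (e i)) (Σ i, Fin (e i)) ℂ →ₗ[ℂ] (CentralizerCoord e R → ℂ) :=
    { toFun := fun Y x => Y ⟨x.1.1.1, ⟨e x.1.1.1 - 1 - x.2, by have := x.2.2; omega⟩⟩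
        ⟨x.1.1.2, ⟨0, by have := x.2.2; omega⟩⟩
      map_add' := fun _ _ => rfl
      map_smul' := fun _ _ => rfl }
  refine LinearMap.finrank_le_finrank_of_injective (f := F ∘ₗ Submodule.subtype _) ?_
  rw [← LinearMap.ker_eq_bot, LinearMap.ker_eq_bot']
  rintro ⟨Y, hY⟩ hF
  have hF' : F Y = 0 := hF
  obtain ⟨hD, hN⟩ := hY
  have hzero : ∀ i j k l, ¬ R i j → Y ⟨i, k⟩ ⟨j, l⟩ = 0 := by
    intro i j k l hij
    by_contra hne
    refine hij (hR i j fun a => ?_)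
    have h1 := congrFun (congrFun (hD a) ⟨i, k⟩) ⟨j, l⟩
    rw [Matrix.diagonal_mul, Matrix.smul_apply, Matrix.mul_diagonal, smul_eq_mul] at h1
    have h2 : (S i a - c * S j a) * Y ⟨i, k⟩ ⟨j, l⟩ = 0 := by linear_combination h1
    exact sub_eq_zero.mp ((mul_eq_zero.mp h2).resolve_right hne)
  have hshift : ∀ i j (k : Fin (e i)) (l : Fin (e j)),
      (if h : 0 < (k : ℕ) then Y ⟨i, ⟨k - 1, by omega⟩⟩ ⟨j, l⟩ else 0) =
      c * (if h : (l : ℕ) + 1 < e j then Y ⟨i, k⟩ ⟨j, ⟨l + 1, h⟩⟩ else 0) := by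
    intro i j k l
    have h1 := congrFun (congrFun hN ⟨i, k⟩) ⟨j, l⟩
    rwa [jordanMatrix_zero_mul_apply, Matrix.smul_apply, mul_jordanMatrix_zero_apply,
      smul_eq_mul] at h1
  -- In the last column the right side of `hshift` is zero, which kills every entry not in the
  -- bottom row. The induction carries these zeros up and to the left along diagonals.
  have hdown : ∀ i j (d k l : ℕ) (hk : k < e i) (hl : l < e j), l + d + 1 = e j →
      k + d + 1 < e i → Y ⟨i, ⟨k, hk⟩⟩ ⟨j, ⟨l, hl⟩⟩ = 0 := by
    intro i j d
    induction d with
    | zero =>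
      intro k l hk hl h1 h2
      have := hshift i j ⟨k + 1, by omega⟩ ⟨l, hl⟩
      simpa [show ¬ (l + 1 < e j) by omega] using this
    | succ d ih =>
      intro k l hk hl h1 h2
      have := hshift i j ⟨k + 1, by omega⟩ ⟨l, hl⟩
      rw [dif_pos (by simp), dif_pos (by simp; omega)] at this
      have h3 := ih (k + 1) (l + 1) (by omega) (by omega) (by omega) (by omega)
      rw [h3, mul_zero] at this
      exact this
  have hcol : ∀ i j (k : ℕ) (hk : k < e i) (hl : 0 < e j), Y ⟨i, ⟨k, hk⟩⟩ ⟨j, ⟨0, hl⟩⟩ = 0 := by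
    intro i j k hk hl
    by_cases hij : R i j
    · by_cases hk' : e i - 1 - k < min (e i) (e j)
      · have := congrFun hF' ⟨⟨(i, j), hij⟩, ⟨e i - 1 - k, hk'⟩⟩
        have h2 : e i - 1 - (e i - 1 - k) = k := by omega
        have h3 : Y ⟨i, ⟨e i - 1 - (e i - 1 - k), by omega⟩⟩ ⟨j, ⟨0, hl⟩⟩ = 0 := this
        simpa only [h2] using h3
      · exact hdown i j (e j - 1) k 0 hk hl (by omega) (by omega)
    · exact hzero _ _ _ _ hij
  have hall : ∀ i j (l k : ℕ) (hk : k < e i) (hl : l < e j),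
      Y ⟨i, ⟨k, hk⟩⟩ ⟨j, ⟨l, hl⟩⟩ = 0 := by
    intro i j l
    induction l with
    | zero => exact fun k hk hl => hcol i j k hk hl
    | succ l ih =>
      intro k hk hl
      have := hshift i j ⟨k, hk⟩ ⟨l, by omega⟩
      rw [dif_pos hl] at this
      have h0 : c * Y ⟨i, ⟨k, hk⟩⟩ ⟨j, ⟨l + 1, hl⟩⟩ = 0 := by
        rw [← this]
        split_ifs with h
        · exact ih _ _ _
        · rfl
      exact (mul_eq_zero.mp h0).resolve_left hc
  refine Subtype.ext ?_
  ext ⟨i, k⟩ ⟨j, l⟩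
  exact hall i j l k k.2 l.2

/-- Blocks constant along diagonals commute with the shift. The index `e i - 1 - k + l` names the
diagonal by its distance from the bottom-left corner, and diagonals at distance `min (e i) (e j)` or
more are set to zero. -/
theorem le_finrank_twistedCentralizer_jordanMatrix {m : ℕ} (S : ι → Fin m → ℂ)
    (R : ι → ι → Prop) [DecidableRel R] (hR : ∀ i j, R i j → ∀ a, S i a = S j a) :
    (∑ i, ∑ j, if R i j then min (e i) (e j) else 0) ≤
    Module.finrank ℂ (twistedCentralizer 1
      (fun a => Matrix.diagonal fun p : Σ i, Fin (e i) => S p.1 a) (jordanMatrix e 0)) := by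
  rw [← finrank_centralizerCoord]
  let G : (CentralizerCoord e R → ℂ) →ₗ[ℂ] Matrix (Σ i, Fin (e i)) (Σ i, Fin (e i)) ℂ :=
    { toFun := fun v => Matrix.of fun p q =>
        if h : R p.1 q.1 ∧ e p.1 - 1 - p.2 + q.2 < min (e p.1) (e q.1) then
          v ⟨⟨(p.1, q.1), h.1⟩, ⟨_, h.2⟩⟩ else 0
      map_add' := fun v w => by
        ext p q
        simp only [Matrix.of_apply, Matrix.add_apply]
        split_ifs <;> simp
      map_smul' := fun c v => by
        ext p q
        simp only [Matrix.of_apply, Matrix.smul_apply]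
        split_ifs <;> simp }
  have hG : ∀ v p q, G v p q = if h : R p.1 q.1 ∧ e p.1 - 1 - p.2 + q.2 < min (e p.1) (e q.1) then
          v ⟨⟨(p.1, q.1), h.1⟩, ⟨_, h.2⟩⟩ else 0 := fun _ _ _ => rfl
  have hmem : ∀ v, G v ∈ twistedCentralizer 1
      (fun a => Matrix.diagonal fun p : Σ i, Fin (e i) => S p.1 a) (jordanMatrix e 0) := by
    intro v
    refine ⟨fun a => ?_, ?_⟩
    · ext p q
      rw [Matrix.diagonal_mul, Matrix.smul_apply, Matrix.mul_diagonal, one_smul, hG]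
      split_ifs with h
      · rw [hR _ _ h.1, mul_comm]
      · simp
    · ext ⟨i, k⟩ ⟨j, l⟩
      rw [jordanMatrix_zero_mul_apply, Matrix.smul_apply, mul_jordanMatrix_zero_apply, one_smul]
      simp only [hG]
      have hk := k.2
      have hl := l.2
      by_cases hij : R i j
      · by_cases hk0 : 0 < (k : ℕ)
        · by_cases hl1 : (l : ℕ) + 1 < e j
          · rw [dif_pos hk0, dif_pos hl1]
            have : e i - 1 - (k - 1 : ℕ) + l = e i - 1 - k + (l + 1) := by omega
            simp only [this]
          · rw [dif_neg hl1, dif_pos hk0, dif_neg]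
            simp; omega
        · rw [dif_neg hk0]
          split_ifs with h1 h2
          · simp at h2; omega
          · rfl
          · rfl
      · simp [hij]
  refine LinearMap.finrank_le_finrank_of_injective (f := G.codRestrict _ hmem) ?_
  rw [← LinearMap.ker_eq_bot, LinearMap.ker_eq_bot']
  intro v hv
  have hv' : G v = 0 := congrArg Subtype.val hv
  ext ⟨⟨⟨i, j⟩, hij⟩, s⟩
  have hs : (s : ℕ) < min (e i) (e j) := s.2
  have h1 := congrFun (congrFun hv' ⟨i, ⟨e i - 1 - s, by omega⟩⟩) ⟨j, ⟨0, by omega⟩⟩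
  rw [hG, dif_pos ⟨hij, by simp only; omega⟩] at h1
  refine Eq.trans ?_ h1
  congr 2
  ext
  simp only
  omega

end JordanCentralizer

/-! ### The combinatorial inequality on block sizes and eigenvalues -/

section EigenvaluePairs

variable {r : ℕ} (e : Fin r → ℕ) (μ : Fin r → ℂ)

/-- A half of the nonzero complex numbers, containing exactly one of `z` and `-z`. -/
def IsUpper (z : ℂ) : Prop := 0 < z.re ∨ (z.re = 0 ∧ 0 < z.im)

theorem IsUpper.ne_zero {z : ℂ} (h : IsUpper z) : z ≠ 0 := by
  rintro rfl
  simp [IsUpper] at h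

theorem IsUpper.not_neg {z : ℂ} (h : IsUpper z) : ¬ IsUpper (-z) := by
  rcases h with h | ⟨h, h'⟩ <;> rintro (h1 | ⟨h1, h2⟩) <;> simp at * <;> linarith

theorem isUpper_or_neg {z : ℂ} (h : z ≠ 0) : IsUpper z ∨ IsUpper (-z) := by
  rcases lt_trichotomy z.re 0 with h1 | h1 | h1
  · exact Or.inr (Or.inl (by simpa using h1))
  · rcases lt_trichotomy z.im 0 with h2 | h2 | h2
    · exact Or.inr (Or.inr (by simp [h1, h2]))
    · exact absurd (Complex.ext h1 h2) h
    · exact Or.inl (Or.inr ⟨h1, h2⟩)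
  · exact Or.inl (Or.inl h1)

/-- The symmetrized spectrum. -/
noncomputable def symmSpectrum {r : ℕ} (μ : Fin r → ℂ) : Finset ℂ :=
  Finset.univ.image μ ∪ Finset.univ.image (fun i => -μ i)

theorem mem_symmSpectrum {z : ℂ} : z ∈ symmSpectrum μ ↔ ∃ i, μ i = z ∨ μ i = -z := by
  simp only [symmSpectrum, Finset.mem_union, Finset.mem_image, Finset.mem_univ, true_and,
    exists_or, neg_eq_iff_eq_neg]

theorem neg_mem_symmSpectrum {z : ℂ} : -z ∈ symmSpectrum μ ↔ z ∈ symmSpectrum μ := by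
  simp only [mem_symmSpectrum, neg_neg, or_comm]

open Classical in
/-- Representatives of the nonzero eigenvalues up to sign. -/
noncomputable def upperSpectrum {r : ℕ} (μ : Fin r → ℂ) : Finset ℂ :=
  (symmSpectrum μ).filter IsUpper

theorem sum_symmSpectrum_neg (f : ℂ → ℤ) :
    ∑ z ∈ symmSpectrum μ, f (-z) = ∑ z ∈ symmSpectrum μ, f z :=
  Finset.sum_bij' (fun z _ => -z) (fun z _ => -z)
    (fun _ hz => (neg_mem_symmSpectrum μ).mpr hz) (fun _ hz => (neg_mem_symmSpectrum μ).mpr hz)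
    (fun _ _ => neg_neg _) (fun _ _ => neg_neg _) (fun _ _ => rfl)

theorem two_mul_card_upperSpectrum :
    2 * (upperSpectrum μ).card = ((symmSpectrum μ).filter (· ≠ 0)).card := by
  classical
  have h1 : (symmSpectrum μ).filter (· ≠ 0) =
      upperSpectrum μ ∪ (upperSpectrum μ).image (fun z => -z) := by
    ext z
    simp only [upperSpectrum, Finset.mem_filter, Finset.mem_union, Finset.mem_image]
    constructor
    · rintro ⟨hz, h0⟩
      rcases isUpper_or_neg h0 with h | h
      · exact Or.inl ⟨hz, h⟩
      · exact Or.inr ⟨-z, ⟨(neg_mem_symmSpectrum μ).mpr hz, h⟩, neg_neg z⟩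
    · rintro (⟨hz, h⟩ | ⟨w, ⟨hw, h⟩, rfl⟩)
      · exact ⟨hz, h.ne_zero⟩
      · exact ⟨(neg_mem_symmSpectrum μ).mpr hw, neg_ne_zero.mpr h.ne_zero⟩
  rw [h1, Finset.card_union_of_disjoint, Finset.card_image_of_injective _ neg_injective]
  · omega
  · rw [Finset.disjoint_left]
    intro z hz hz'
    obtain ⟨w, hw, rfl⟩ := Finset.mem_image.mp hz'
    simp only [upperSpectrum, Finset.mem_filter] at hz hw
    exact hw.2.not_neg hz.2

/-- The number of Jordan blocks with eigenvalue `z` and size greater than `k`. -/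
noncomputable def blockCount {r : ℕ} (e : Fin r → ℕ) (μ : Fin r → ℂ) (k : ℕ) (z : ℂ) : ℤ :=
  ∑ i, if μ i = z ∧ k < e i then 1 else 0

theorem blockCount_nonneg (k : ℕ) (z : ℂ) : 0 ≤ blockCount e μ k z :=
  Finset.sum_nonneg fun _ _ => by split_ifs <;> simp

theorem min_eq_sum_range {a b K : ℕ} (ha : a ≤ K) :
    ((min a b : ℕ) : ℤ) = ∑ k ∈ Finset.range K, if k < a ∧ k < b then 1 else 0 := by
  rw [Finset.sum_boole]
  have : (Finset.range K).filter (fun k => k < a ∧ k < b) = Finset.range (min a b) := by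
    ext k
    simp
    omega
  rw [this, Finset.card_range]

/-- `min a b` counts the `k` below both `a` and `b`; exchange the sums. It is used with `σ` the
negation and the identity. -/
theorem sum_min_eq_sum_blockCount {K : ℕ} (hK : ∀ i, e i ≤ K) (σ : ℂ → ℂ)
    (hσ : ∀ z, σ (σ z) = z) :
    ((∑ i, ∑ j, if μ i = σ (μ j) then min (e i) (e j) else 0 : ℕ) : ℤ) =
      ∑ k ∈ Finset.range K, ∑ z ∈ symmSpectrum μ, blockCount e μ k z * blockCount e μ k (σ z) := by
  have h1 : ∀ i j, ((if μ i = σ (μ j) then min (e i) (e j) else 0 : ℕ) : ℤ) =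
      ∑ k ∈ Finset.range K, ∑ z ∈ symmSpectrum μ,
        (if μ i = z ∧ k < e i then 1 else 0) * (if μ j = σ z ∧ k < e j then 1 else 0) := by
    intro i j
    have h2 : ∀ k, ∑ z ∈ symmSpectrum μ,
        (if μ i = z ∧ k < e i then (1 : ℤ) else 0) * (if μ j = σ z ∧ k < e j then 1 else 0) =
        if μ i = σ (μ j) then (if k < e i ∧ k < e j then 1 else 0) else 0 := by
      intro k
      have hiff : μ j = σ (μ i) ↔ μ i = σ (μ j) :=
        ⟨fun h => by rw [h, hσ], fun h => by rw [h, hσ]⟩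
      rw [Finset.sum_eq_single (μ i)]
      · simp only [true_and, hiff]
        split_ifs <;> simp_all
      · intro z _ hz
        simp [hz.symm]
      · intro h
        exact absurd ((mem_symmSpectrum μ).mpr ⟨i, Or.inl rfl⟩) h
    rw [Finset.sum_congr rfl fun k _ => h2 k]
    split_ifs
    · exact min_eq_sum_range (hK i)
    · simp
  simp only [Nat.cast_sum, h1]
  simp only [blockCount, Finset.sum_mul_sum]
  have h3 : ∀ i : Fin r, ∑ j : Fin r, ∑ k ∈ Finset.range K, ∑ z ∈ symmSpectrum μ,
        (if μ i = z ∧ k < e i then (1 : ℤ) else 0) * (if μ j = σ z ∧ k < e j then 1 else 0) =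
      ∑ k ∈ Finset.range K, ∑ z ∈ symmSpectrum μ, ∑ j : Fin r,
        (if μ i = z ∧ k < e i then (1 : ℤ) else 0) * (if μ j = σ z ∧ k < e j then 1 else 0) := by
    intro i
    rw [Finset.sum_comm]
    refine Finset.sum_congr rfl fun k _ => Finset.sum_comm
  rw [Finset.sum_congr rfl fun i _ => h3 i, Finset.sum_comm]
  exact Finset.sum_congr rfl fun k _ => Finset.sum_comm

theorem blockCount_add_neg_pos (he : ∀ i, 0 < e i) {z : ℂ} (hz : z ∈ symmSpectrum μ) :
    1 ≤ blockCount e μ 0 z + blockCount e μ 0 (-z) := by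
  obtain ⟨i, hi⟩ := (mem_symmSpectrum μ).mp hz
  have key : ∀ w, μ i = w → 1 ≤ blockCount e μ 0 w := by
    intro w hw
    have := Finset.single_le_sum (f := fun i => if μ i = w ∧ 0 < e i then (1 : ℤ) else 0)
      (fun _ _ => by split_ifs <;> simp) (Finset.mem_univ i)
    exact (if_pos (⟨hw, he i⟩ : μ i = w ∧ 0 < e i)).symm.le.trans this
  have h1 := blockCount_nonneg e μ 0 z
  have h2 := blockCount_nonneg e μ 0 (-z)
  rcases hi with hi | hi
  · linarith [key _ hi]
  · linarith [key _ hi]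

theorem sum_blockCount_zero (he : ∀ i, 0 < e i) :
    ∑ z ∈ symmSpectrum μ, blockCount e μ 0 z ≤ ∑ i, (e i : ℤ) := by
  simp only [blockCount]
  rw [Finset.sum_comm]
  refine Finset.sum_le_sum fun i _ => ?_
  rw [Finset.sum_eq_single (μ i)]
  · have := he i
    simp [he i]
    omega
  · intro z _ hz
    simp [hz.symm]
  · intro h
    exact absurd ((mem_symmSpectrum μ).mpr ⟨i, Or.inl rfl⟩) h

/-- Twice the difference of the two sums of minima is a sum of squares `(b k z - b k (-z))²`. Each
`z` in the symmetrized spectrum satisfies `b 0 z + b 0 (-z) + 2 (b 0 z - b 0 (-z))² ≥ 2`. Summing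
over `z`, and using that there are at most `∑ e i` blocks, gives the inequality doubled; integrality
supplies the floor. -/
theorem card_upperSpectrum_add_le (he : ∀ i, 0 < e i) :
    (upperSpectrum μ).card + (∑ i, ∑ j, if μ i = -μ j then min (e i) (e j) else 0) ≤
      (∑ i, e i) / 2 + ∑ i, ∑ j, if μ i = μ j then min (e i) (e j) else 0 := by
  -- The extra `1` keeps `k = 0` in the range even when there are no blocks.
  have hK : ∀ i, e i ≤ (∑ i, e i) + 1 := fun i =>
    (Finset.single_le_sum (fun _ _ => Nat.zero_le _) (Finset.mem_univ i)).trans (Nat.le_succ _)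
  have hA := sum_min_eq_sum_blockCount e μ hK (fun z => -z) neg_neg
  have hZ := sum_min_eq_sum_blockCount e μ hK id (fun _ => rfl)
  simp only [id] at hZ
  have hc := two_mul_card_upperSpectrum μ
  have hn := sum_blockCount_zero e μ he
  set A := ∑ i, ∑ j, if μ i = -μ j then min (e i) (e j) else 0
  set Z := ∑ i, ∑ j, if μ i = μ j then min (e i) (e j) else 0
  set b := blockCount e μ
  have hsq : 2 * (Z : ℤ) - 2 * A = ∑ k ∈ Finset.range ((∑ i, e i) + 1),
      ∑ z ∈ symmSpectrum μ, (b k z - b k (-z)) ^ 2 := by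
    rw [hA, hZ, Finset.mul_sum, Finset.mul_sum, ← Finset.sum_sub_distrib]
    refine Finset.sum_congr rfl fun k _ => ?_
    have h1 := sum_symmSpectrum_neg μ fun z => b k z * b k z
    have h2 : ∑ z ∈ symmSpectrum μ, (b k z - b k (-z)) ^ 2 =
        ∑ z ∈ symmSpectrum μ, b k z * b k z + ∑ z ∈ symmSpectrum μ, b k (-z) * b k (-z) -
          2 * ∑ z ∈ symmSpectrum μ, b k z * b k (-z) := by
      rw [Finset.mul_sum, ← Finset.sum_add_distrib, ← Finset.sum_sub_distrib]
      exact Finset.sum_congr rfl fun z _ => by ring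
    rw [h2, h1]
    ring
  have hge : ∑ z ∈ symmSpectrum μ, (b 0 z - b 0 (-z)) ^ 2 ≤ 2 * (Z : ℤ) - 2 * A := by
    rw [hsq]
    exact Finset.single_le_sum (f := fun k => ∑ z ∈ symmSpectrum μ, (b k z - b k (-z)) ^ 2)
      (fun _ _ => Finset.sum_nonneg fun _ _ => sq_nonneg _) (Finset.mem_range.mpr (Nat.succ_pos _))
  have hmain : 2 * (((symmSpectrum μ).filter (· ≠ 0)).card : ℤ) ≤
      ∑ z ∈ symmSpectrum μ, (b 0 z + b 0 (-z) + 2 * (b 0 z - b 0 (-z)) ^ 2) := by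
    have h1 : 2 * (((symmSpectrum μ).filter (· ≠ 0)).card : ℤ) ≤ ∑ z ∈ symmSpectrum μ, 2 := by
      rw [Finset.sum_const, nsmul_eq_mul, mul_comm]
      have := Finset.card_filter_le (symmSpectrum μ) (· ≠ 0)
      gcongr
    refine h1.trans (Finset.sum_le_sum fun z hz => ?_)
    have h2 := blockCount_add_neg_pos e μ he hz
    change 1 ≤ b 0 z + b 0 (-z) at h2
    -- If the two counts agree, their sum is even and positive, hence at least `2`; otherwise the
    -- square contributes at least `1`.
    rcases eq_or_ne (b 0 z) (b 0 (-z)) with h | h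
    · have h3 : (b 0 z - b 0 (-z)) ^ 2 = 0 := by rw [h]; ring
      rw [h3]
      omega
    · have : 0 < (b 0 z - b 0 (-z)) ^ 2 := by
        have := sub_ne_zero.mpr h
        positivity
      linarith
  rw [Finset.sum_add_distrib, Finset.sum_add_distrib, sum_symmSpectrum_neg μ (b 0),
    ← Finset.mul_sum] at hmain
  have hfin : 2 * ((upperSpectrum μ).card : ℤ) + 2 * A ≤ ((∑ i, e i : ℕ) : ℤ) + 2 * Z := by
    push_cast at hn ⊢
    have : (2 * ((upperSpectrum μ).card : ℤ)) = (((symmSpectrum μ).filter (· ≠ 0)).card : ℤ) := by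
      exact_mod_cast hc
    linarith
  omega

end EigenvaluePairs

/-! ### Stratification by Jordan type -/

/-- A block with `μ i ≠ -μ j` vanishes, as in Sylvester's equation. In the other blocks the
eigenvalues cancel and only the nilpotent relation is left. The resulting linear space depends on
the eigenvalues only through the signs `S`. -/
theorem anticommute_jordanMatrix_mem_twistedCentralizer {ι : Type*} [Fintype ι] [DecidableEq ι]
    {e : ι → ℕ} {m : ℕ} {μ : ι → ℂ} {S : ι → Fin m → ℂ}
    (hS : ∀ i j, μ i = -μ j → ∀ a, S i a = -S j a)
    {Y : Matrix (Σ i, Fin (e i)) (Σ i, Fin (e i)) ℂ}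
    (hY : jordanMatrix e μ * Y + Y * jordanMatrix e μ = 0) :
    Y ∈ twistedCentralizer (-1)
      (fun a => Matrix.diagonal fun p : Σ i, Fin (e i) => S p.1 a) (jordanMatrix e 0) := by
  have hJ : jordanMatrix e μ = jordanMatrix e 0 + Matrix.diagonal fun p => μ p.1 := by
    ext p q
    by_cases hpq : p = q
    · subst hpq
      simp [jordanMatrix, add_comm]
    · simp [jordanMatrix, hpq]
  have hentry : ∀ p q, (μ p.1 + μ q.1) * Y p q + (jordanMatrix e 0 * Y) p q +
      (Y * jordanMatrix e 0) p q = 0 := by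
    intro p q
    have h1 := congrFun (congrFun hY p) q
    rw [hJ, add_mul, mul_add, Matrix.add_apply, Matrix.add_apply, Matrix.add_apply,
      Matrix.diagonal_mul, Matrix.mul_diagonal, Matrix.zero_apply] at h1
    linear_combination h1
  -- The distance `d` to the top-right corner of the block decreases in both shifted terms, so `μ i
  -- + μ j ≠ 0` can be divided out at each stage.
  have hblock : ∀ i j, μ i ≠ -μ j → ∀ (d k l : ℕ) (hk : k < e i) (hl : l < e j),
      k + (e j - 1 - l) = d → Y ⟨i, ⟨k, hk⟩⟩ ⟨j, ⟨l, hl⟩⟩ = 0 := by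
    intro i j hij d
    induction d using Nat.strong_induction_on with
    | _ d ih =>
      intro k l hk hl hd
      have h1 := hentry ⟨i, ⟨k, hk⟩⟩ ⟨j, ⟨l, hl⟩⟩
      have h2 : (jordanMatrix e 0 * Y) ⟨i, ⟨k, hk⟩⟩ ⟨j, ⟨l, hl⟩⟩ = 0 := by
        rw [jordanMatrix_zero_mul_apply]
        split_ifs with h
        · have h' : 0 < k := h
          exact ih (k - 1 + (e j - 1 - l)) (by omega) _ _ _ _ rfl
        · rfl
      have h3 : (Y * jordanMatrix e 0) ⟨i, ⟨k, hk⟩⟩ ⟨j, ⟨l, hl⟩⟩ = 0 := by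
        rw [mul_jordanMatrix_zero_apply]
        split_ifs with h
        · have h' : l + 1 < e j := h
          exact ih (k + (e j - 1 - (l + 1))) (by omega) _ _ _ _ rfl
        · rfl
      rw [h2, h3, add_zero, add_zero] at h1
      exact (mul_eq_zero.mp h1).resolve_left fun h => hij (eq_neg_of_add_eq_zero_left h)
  have hblock' : ∀ p q, μ p.1 ≠ -μ q.1 → Y p q = 0 := fun p q h =>
    hblock p.1 q.1 h _ p.2 q.2 p.2.2 q.2.2 rfl
  refine ⟨fun a => ?_, ?_⟩
  · ext p q
    rw [Matrix.diagonal_mul, Matrix.smul_apply, Matrix.mul_diagonal, smul_eq_mul]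
    by_cases h : μ p.1 = -μ q.1
    · rw [hS _ _ h]
      ring
    · rw [hblock' p q h]
      ring
  · ext ⟨i, k⟩ ⟨j, l⟩
    rw [Matrix.smul_apply, smul_eq_mul]
    by_cases h : μ i = -μ j
    · have h1 := hentry ⟨i, k⟩ ⟨j, l⟩
      rw [show μ (Sigma.fst (⟨i, k⟩ : Σ i, Fin (e i))) + μ (Sigma.fst (⟨j, l⟩ : Σ i, Fin (e i))) = 0 by
        simp [h]] at h1
      linear_combination h1
    · rw [jordanMatrix_zero_mul_apply, mul_jordanMatrix_zero_apply]
      simp [hblock' ⟨i, _⟩ ⟨j, _⟩ h]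

/-- The sign with which each representative in `upperSpectrum μ` occurs as `μ i`. -/
noncomputable def signPattern {r : ℕ} (μ : Fin r → ℂ) (i : Fin r)
    (a : Fin (upperSpectrum μ).card) : ℤ :=
  if μ i = (upperSpectrum μ).equivFin.symm a then 1
  else if μ i = -(upperSpectrum μ).equivFin.symm a then -1 else 0

theorem isUpper_of_mem_upperSpectrum {r : ℕ} {μ : Fin r → ℂ} {z : ℂ} (h : z ∈ upperSpectrum μ) :
    IsUpper z := by
  simp only [upperSpectrum, Finset.mem_filter] at h
  exact h.2

theorem signPattern_neg {r : ℕ} {μ : Fin r → ℂ} {i j : Fin r} (h : μ i = -μ j)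
    (a : Fin (upperSpectrum μ).card) : signPattern μ i a = -signPattern μ j a := by
  have hz := isUpper_of_mem_upperSpectrum ((upperSpectrum μ).equivFin.symm a).2
  have hne : ((upperSpectrum μ).equivFin.symm a : ℂ) ≠ -((upperSpectrum μ).equivFin.symm a : ℂ) :=
    fun h => hz.not_neg (h ▸ hz)
  simp only [signPattern, h, neg_eq_iff_eq_neg, neg_neg]
  split_ifs with h1 h2 h2
  · exact absurd (h2.symm.trans h1) hne
  · simp
  · simp
  · simp

theorem signPattern_congr {r : ℕ} {μ : Fin r → ℂ} {i j : Fin r} (h : μ i = μ j)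
    (a : Fin (upperSpectrum μ).card) : signPattern μ i a = signPattern μ j a := by
  simp only [signPattern, h]

/-- At most one term survives: exactly one of `μ i` and `-μ i` is a chosen representative when `μ i
≠ 0`, and neither is when `μ i = 0`. -/
theorem sum_signPattern {r : ℕ} (μ : Fin r → ℂ) (i : Fin r) :
    μ i = ∑ a, ((upperSpectrum μ).equivFin.symm a : ℂ) * (signPattern μ i a : ℂ) := by
  classical
  have hs : ∀ a, (signPattern μ i a : ℂ) = (fun z : upperSpectrum μ =>
      if μ i = z then (1 : ℂ) else if μ i = -z then -1 else 0) ((upperSpectrum μ).equivFin.symm a) := by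
    intro a
    simp only [signPattern]
    split_ifs <;> simp
  have h1 : ∑ a, ((upperSpectrum μ).equivFin.symm a : ℂ) * (signPattern μ i a : ℂ) =
      ∑ z ∈ upperSpectrum μ, z * (if μ i = z then (1 : ℂ) else if μ i = -z then -1 else 0) := by
    rw [Finset.sum_congr rfl fun a _ => by rw [hs a]]
    rw [(upperSpectrum μ).equivFin.symm.sum_comp (fun z : upperSpectrum μ =>
      (z : ℂ) * (if μ i = z then (1 : ℂ) else if μ i = -z then -1 else 0))]
    exact Finset.sum_coe_sort (upperSpectrum μ) fun z : ℂ =>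
      z * (if μ i = z then (1 : ℂ) else if μ i = -z then -1 else 0)
  rw [h1]
  have hmem : ∀ z, z ∈ upperSpectrum μ ↔ z ∈ symmSpectrum μ ∧ IsUpper z := by
    intro z
    simp only [upperSpectrum, Finset.mem_filter]
  by_cases h0 : μ i = 0
  · rw [h0]
    symm
    refine Finset.sum_eq_zero fun z hz => ?_
    have := ((hmem z).mp hz).2.ne_zero
    simp [this.symm]
  · rcases isUpper_or_neg h0 with h | h
    · rw [Finset.sum_eq_single (μ i)]
      · simp
      · intro z hz hne
        rw [if_neg hne.symm, if_neg, mul_zero]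
        intro h'
        exact ((hmem z).mp hz).2.not_neg (h' ▸ h)
      · intro h'
        exact absurd ((hmem _).mpr ⟨(mem_symmSpectrum μ).mpr ⟨i, Or.inl rfl⟩, h⟩) h'
    · rw [Finset.sum_eq_single (-μ i)]
      · rw [neg_neg, if_pos rfl, if_neg]
        · ring
        · intro h'
          exact h.ne_zero (by linear_combination (-1 / 2 : ℂ) * h')
      · intro z hz hne
        rw [if_neg, if_neg, mul_zero]
        · intro h'
          exact hne (by rw [h', neg_neg])
        · intro h'
          exact ((hmem z).mp hz).2.not_neg (h' ▸ h)
      · intro h'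
        exact absurd ((hmem _).mpr ⟨(mem_symmSpectrum μ).mpr ⟨i, Or.inr (by simp)⟩, h⟩) h'

/-- The combinatorial type of a Jordan matrix of size `n`: the block sizes, the signs expressing
the eigenvalues through parameters, and a numbering of the basis. -/
abbrev JordanType (n : ℕ) : Type :=
  Σ (r m : ℕ) (e : Fin r → ℕ), (Fin r → Fin m → ℤ) × ((Σ i, Fin (e i)) ≃ Fin n)

namespace JordanType

variable {n : ℕ} (x : JordanType n)

/-- The number of parameters. -/
abbrev params : ℕ := x.2.1

/-- The direction in which each parameter moves the Jordan matrix. -/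
noncomputable def direction (a : Fin x.params) : Matrix (Fin n) (Fin n) ℂ :=
  Matrix.reindexAlgEquiv ℂ ℂ x.2.2.2.2
    (Matrix.diagonal fun p : Σ i, Fin (x.2.2.1 i) => (x.2.2.2.1 p.1 a : ℂ))

/-- The nilpotent part. -/
noncomputable def nilpotent : Matrix (Fin n) (Fin n) ℂ :=
  Matrix.reindexAlgEquiv ℂ ℂ x.2.2.2.2 (jordanMatrix x.2.2.1 0)

end JordanType

/-- Bring `A` to Jordan form by `u` and transport `B` along; the dimension estimate comes from the
two centralizer bounds and `card_upperSpectrum_add_le`. -/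
theorem exists_jordanType {n : ℕ} {A B : Matrix (Fin n) (Fin n) ℂ} (hAB : A * B + B * A = 0) :
    ∃ x : JordanType n,
      (Module.finrank ℂ (Matrix (Fin n) (Fin n) ℂ) + x.params +
        Module.finrank ℂ (twistedCentralizer (-1) x.direction x.nilpotent) ≤
        (n ^ 2 + n / 2) + Module.finrank ℂ (twistedCentralizer 1 x.direction x.nilpotent)) ∧
      ∃ u : (Matrix (Fin n) (Fin n) ℂ)ˣ, ∃ t : Fin x.params → ℂ,
        ∃ y ∈ twistedCentralizer (-1) x.direction x.nilpotent,
          (A, B) = ((u : Matrix (Fin n) (Fin n) ℂ) * (x.nilpotent + ∑ a, t a • x.direction a) *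
            (u⁻¹ : (Matrix (Fin n) (Fin n) ℂ)ˣ), (u : Matrix (Fin n) (Fin n) ℂ) * y *
            (u⁻¹ : (Matrix (Fin n) (Fin n) ℂ)ˣ)) := by
  obtain ⟨r, e, μ, f, u, he, hA⟩ := exists_jordan_normal_form A
  let ρ := Matrix.reindexAlgEquiv ℂ ℂ f
  let x : JordanType n := ⟨r, (upperSpectrum μ).card, e, signPattern μ, f⟩
  let S : Fin r → Fin (upperSpectrum μ).card → ℂ := fun i a => (signPattern μ i a : ℂ)
  let t : Fin x.params → ℂ := fun a => ((upperSpectrum μ).equivFin.symm a : ℂ)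
  have hdir : x.direction = fun a => ρ (Matrix.diagonal fun p : Σ i, Fin (e i) => S p.1 a) := rfl
  have hnil : x.nilpotent = ρ (jordanMatrix e 0) := rfl
  have hJ : jordanMatrix e μ = jordanMatrix e 0 +
      ∑ a, t a • Matrix.diagonal fun p : Σ i, Fin (e i) => S p.1 a :=
    jordanMatrix_eq_add μ S t (sum_signPattern μ)
  refine ⟨x, ?_, u, t, (u⁻¹ : (Matrix (Fin n) (Fin n) ℂ)ˣ) * B * u, ?_, ?_⟩
  · rw [hdir, hnil, finrank_twistedCentralizer_map, finrank_twistedCentralizer_map]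
    have h1 := finrank_twistedCentralizer_jordanMatrix_le (e := e) S (c := -1) (by simp)
      (fun i j => μ i = -μ j) (fun i j h => by
        rw [sum_signPattern μ i, sum_signPattern μ j, ← Finset.sum_neg_distrib]
        refine Finset.sum_congr rfl fun a _ => ?_
        have := h a
        simp only [S] at this
        rw [this]
        ring)
    have h2 := le_finrank_twistedCentralizer_jordanMatrix (e := e) S
      (fun i j => μ i = μ j) (fun i j h a => by simp only [S, signPattern_congr h])
    have h3 := card_upperSpectrum_add_le e μ he
    have h4 : ∑ i, e i = n := by
      have := Fintype.card_congr f
      simpa using this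
    have h5 : Module.finrank ℂ (Matrix (Fin n) (Fin n) ℂ) = n ^ 2 := by
      rw [Module.finrank_matrix]
      simp [sq]
    rw [h4] at h3
    rw [h5]
    change n ^ 2 + (upperSpectrum μ).card + _ ≤ _
    omega
  · have h1 : ρ (jordanMatrix e μ) * ((u⁻¹ : (Matrix (Fin n) (Fin n) ℂ)ˣ) * B * u) +
        ((u⁻¹ : (Matrix (Fin n) (Fin n) ℂ)ˣ) * B * u) * ρ (jordanMatrix e μ) = 0 := by
      have h2 : ρ (jordanMatrix e μ) = (u⁻¹ : (Matrix (Fin n) (Fin n) ℂ)ˣ) * A * u := by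
        rw [hA]
        simp [mul_assoc, ρ]
      rw [h2]
      have h3 : ((u⁻¹ : (Matrix (Fin n) (Fin n) ℂ)ˣ) : Matrix (Fin n) (Fin n) ℂ) *
          (A * B + B * A) * u = 0 := by
        rw [hAB]; simp
      rw [← h3]
      simp only [mul_assoc, Units.mul_inv_cancel_left, mul_add, add_mul]
    obtain ⟨Y, hY⟩ := ρ.surjective ((u⁻¹ : (Matrix (Fin n) (Fin n) ℂ)ˣ) * B * u)
    rw [← hY] at h1 ⊢
    rw [← map_mul, ← map_mul, ← map_add, map_eq_zero_iff ρ ρ.injective] at h1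
    have h4 := anticommute_jordanMatrix_mem_twistedCentralizer (S := S) (fun i j h a => by
      simp only [S, signPattern_neg h, Int.cast_neg]) h1
    rw [hdir, hnil]
    refine ⟨fun a => ?_, ?_⟩
    · rw [← map_mul, ← map_mul, ← map_smul, h4.1 a]
    · rw [← map_mul, ← map_mul, ← map_smul, h4.2]
  · refine Prod.ext ?_ ?_
    · have h1 : x.nilpotent + ∑ a, t a • x.direction a = ρ (jordanMatrix e μ) := by
        rw [hJ, map_add, map_sum, hdir, hnil]
        simp only [map_smul]
      simp only [h1]
      exact hA
    · simp [mul_assoc]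

-- Upper bound for the anticommuting variety

attribute [local instance] Matrix.linftyOpNormedRing Matrix.linftyOpNormedAlgebra

theorem dimH_anticommuting_le (n : ℕ) :
    dimH {p : Matrix (Fin n) (Fin n) ℂ × Matrix (Fin n) (Fin n) ℂ |
      p.1 * p.2 + p.2 * p.1 = 0} ≤ (2 * (n ^ 2 + n / 2) : ℕ) := by
  let I := {x : JordanType n // Module.finrank ℂ (Matrix (Fin n) (Fin n) ℂ) + x.params +
        Module.finrank ℂ (twistedCentralizer (-1) x.direction x.nilpotent) ≤
        (n ^ 2 + n / 2) + Module.finrank ℂ (twistedCentralizer 1 x.direction x.nilpotent)}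
  -- A type records only natural numbers, integer signs and a bijection of finite sets; the
  -- eigenvalues themselves stay in the continuous parameters `t`.
  have : Countable I := inferInstance
  refine (dimH_mono (t := ⋃ x : I, {p | ∃ u : (Matrix (Fin n) (Fin n) ℂ)ˣ,
    ∃ t : Fin x.1.params → ℂ, ∃ y ∈ twistedCentralizer (-1) x.1.direction x.1.nilpotent,
      p = ((u : Matrix (Fin n) (Fin n) ℂ) * (x.1.nilpotent + ∑ a, t a • x.1.direction a) *
            (u⁻¹ : (Matrix (Fin n) (Fin n) ℂ)ˣ), (u : Matrix (Fin n) (Fin n) ℂ) * y *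
            (u⁻¹ : (Matrix (Fin n) (Fin n) ℂ)ˣ))}) ?_).trans ?_
  · rintro ⟨A, B⟩ hAB
    obtain ⟨x, hx, h⟩ := exists_jordanType hAB
    exact Set.mem_iUnion.mpr ⟨⟨x, hx⟩, h⟩
  · rw [dimH_iUnion]
    exact iSup_le fun x => dimH_conj_twistedCentralizer_le (-1) _ _ x.2

/-- The entries of `XY + YX` vanish in the coordinate ring, so the point of the ambient space
attached to a character satisfies the same equations and lies in the variety. -/
theorem varietyDim_anticommuting_le (n : ℕ) :
    varietyDim {p : Matrix (Fin n) (Fin n) ℂ × Matrix (Fin n) (Fin n) ℂ |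
      p.1 * p.2 + p.2 * p.1 = 0} ≤ ((n ^ 2 + n / 2 : ℕ) : WithBot ℕ∞) := by
  refine varietyDim_le_of_dimH_le ?_ ⟨0, by simp⟩ (dimH_anticommuting_le n)
  intro χ
  obtain ⟨v, hv⟩ := exists_eval_of_algHom χ
  have hmem : v.1 * v.2 + v.2 * v.1 = 0 := by
    ext i j
    let φ : Fin n → Fin n → (Matrix (Fin n) (Fin n) ℂ × Matrix (Fin n) (Fin n) ℂ →ₗ[ℂ] ℂ) :=
      fun i j => Matrix.entryLinearMap ℂ ℂ i j ∘ₗ LinearMap.fst ℂ _ _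
    let ψ : Fin n → Fin n → (Matrix (Fin n) (Fin n) ℂ × Matrix (Fin n) (Fin n) ℂ →ₗ[ℂ] ℂ) :=
      fun i j => Matrix.entryLinearMap ℂ ℂ i j ∘ₗ LinearMap.snd ℂ _ _
    have h1 : ∑ k, (restrictLinear _ (φ i k) * restrictLinear _ (ψ k j)) +
        ∑ k, (restrictLinear _ (ψ i k) * restrictLinear _ (φ k j)) =
        (0 : coordinateRing {p : Matrix (Fin n) (Fin n) ℂ × Matrix (Fin n) (Fin n) ℂ |
          p.1 * p.2 + p.2 * p.1 = 0}) := by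
      ext ⟨p, hp⟩
      have := congrFun (congrFun hp i) j
      rw [Matrix.add_apply, Matrix.mul_apply, Matrix.mul_apply] at this
      simpa [restrictLinear, φ, ψ] using this
    have h2 := congrArg χ h1
    simp only [map_add, map_sum, map_mul, hv, map_zero] at h2
    rw [Matrix.add_apply, Matrix.mul_apply, Matrix.mul_apply]
    exact h2
  exact ⟨⟨v, hmem⟩, fun f => algHom_eq_eval χ ⟨v, hmem⟩ hv f⟩

/-! ### Lower bound from a generic family -/

section LowerBound

variable (n : ℕ)

/-- Diagonal matrices with eigenvalues `α i` and `-α i` in positions `i` and `rev i`. -/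
noncomputable def oddDiagonal : (Fin (n - n / 2) → ℂ) →ₗ[ℂ] Matrix (Fin n) (Fin n) ℂ where
  toFun α := Matrix.diagonal fun i =>
    if h : (i : ℕ) < n - n / 2 then α ⟨i, h⟩ else -α ⟨n - 1 - i, by omega⟩
  map_add' α β := by
    ext i j
    by_cases h : i = j
    · subst h
      simp only [Matrix.diagonal_apply_eq, Matrix.add_apply, Pi.add_apply]
      split_ifs <;> ring
    · simp [h]
  map_smul' c α := by
    ext i j
    by_cases h : i = j
    · subst h
      simp only [Matrix.diagonal_apply_eq, Matrix.smul_apply, Pi.smul_apply, smul_eq_mul,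
        RingHom.id_apply]
      split_ifs <;> ring
    · simp [h]

/-- Matrices supported on the antidiagonal, away from the center. -/
noncomputable def antidiagonal :
    (Fin (n / 2) → ℂ) × (Fin (n / 2) → ℂ) →ₗ[ℂ] Matrix (Fin n) (Fin n) ℂ where
  toFun β := Matrix.of fun i j => if (i : ℕ) + j = n - 1 then
    (if h : (i : ℕ) < n / 2 then β.1 ⟨i, h⟩ else if h' : (j : ℕ) < n / 2 then β.2 ⟨j, h'⟩ else 0)
    else 0
  map_add' β γ := by
    ext i j
    simp only [Matrix.of_apply, Matrix.add_apply, Prod.fst_add, Prod.snd_add, Pi.add_apply]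
    split_ifs <;> simp
  map_smul' c β := by
    ext i j
    simp only [Matrix.of_apply, Matrix.smul_apply, Prod.smul_fst, Prod.smul_snd, Pi.smul_apply,
      RingHom.id_apply]
    split_ifs <;> simp

/-- An antidiagonal entry at `(i, j)` is multiplied by the sum of the `i`-th and `j`-th diagonal
entries, which are opposite. For odd `n` the central diagonal entry is free, and the central
antidiagonal entry is zero. -/
theorem oddDiagonal_anticommute_antidiagonal (α : Fin (n - n / 2) → ℂ)
    (β : (Fin (n / 2) → ℂ) × (Fin (n / 2) → ℂ)) :
    oddDiagonal n α * antidiagonal n β + antidiagonal n β * oddDiagonal n α = 0 := by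
  ext i j
  have hi := i.2
  have hj := j.2
  simp only [oddDiagonal, antidiagonal, LinearMap.coe_mk, AddHom.coe_mk, Matrix.add_apply,
    Matrix.diagonal_mul, Matrix.mul_diagonal, Matrix.of_apply, Matrix.zero_apply]
  by_cases hij : (i : ℕ) + j = n - 1
  · simp only [if_pos hij]
    have e1 : n - 1 - (i : ℕ) = j := by omega
    have e2 : n - 1 - (j : ℕ) = i := by omega
    by_cases h1 : (i : ℕ) < n / 2
    · rw [dif_pos h1, dif_pos (by omega), dif_neg (by omega)]
      simp only [e2]
      ring
    · rw [dif_neg h1]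
      by_cases h2 : (j : ℕ) < n / 2
      · rw [dif_pos h2, dif_neg (by omega), dif_pos (by omega)]
        simp only [e1]
        ring
      · simp [h2]
  · simp [hij]

/-- Tangent space of the parameter space of the generic stratum. -/
abbrev AnticommutingParam : Type :=
  Matrix (Fin n) (Fin n) ℂ × (Fin (n - n / 2) → ℂ) × ((Fin (n / 2) → ℂ) × (Fin (n / 2) → ℂ))

/-- A parametrization of anticommuting pairs: conjugates of pairs consisting of an odd diagonal and
an antidiagonal matrix. -/
noncomputable def anticommutingParam (q : AnticommutingParam n) :
    Matrix (Fin n) (Fin n) ℂ × Matrix (Fin n) (Fin n) ℂ :=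
  ((1 + q.1) * oddDiagonal n q.2.1 * Ring.inverse (1 + q.1),
    (1 + q.1) * antidiagonal n q.2.2 * Ring.inverse (1 + q.1))

theorem anticommutingParam_mem {q : AnticommutingParam n} (hq : IsUnit (1 + q.1)) :
    (anticommutingParam n q).1 * (anticommutingParam n q).2 +
      (anticommutingParam n q).2 * (anticommutingParam n q).1 = 0 := by
  obtain ⟨u, hu⟩ := hq
  have h := oddDiagonal_anticommute_antidiagonal n q.2.1 q.2.2
  simp only [anticommutingParam, ← hu, Ring.inverse_unit]
  have h3 : (u : Matrix (Fin n) (Fin n) ℂ) * (oddDiagonal n q.2.1 * antidiagonal n q.2.2 +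
      antidiagonal n q.2.2 * oddDiagonal n q.2.1) * (u⁻¹ : (Matrix (Fin n) (Fin n) ℂ)ˣ) = 0 := by
    rw [h]; simp
  rw [← h3]
  simp only [mul_assoc, Units.inv_mul_cancel_left, mul_add, add_mul]

/-- A base point with distinct diagonal entries. -/
noncomputable def baseDiagonal : Fin (n - n / 2) → ℂ := fun i => (i : ℂ) + 1

/-- The first `n - n / 2` entries are positive and the others negative; the shift by `1` in
`baseDiagonal` keeps zero out. -/
theorem oddDiagonal_baseDiagonal_injective {i j : Fin n}
    (h : oddDiagonal n (baseDiagonal n) i i = oddDiagonal n (baseDiagonal n) j j) : i = j := by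
  simp only [oddDiagonal, baseDiagonal, LinearMap.coe_mk, AddHom.coe_mk,
    Matrix.diagonal_apply_eq] at h
  have hi := i.2
  have hj := j.2
  split_ifs at h
  · have : ((i : ℕ) : ℂ) = (j : ℕ) := by linear_combination h
    exact Fin.ext (Nat.cast_injective this)
  · exfalso
    have : (((i : ℕ) + 1 + (n - 1 - j + 1) : ℕ) : ℂ) = (0 : ℕ) := by
      push_cast
      linear_combination h
    have := Nat.cast_injective this
    omega
  · exfalso
    have : (((j : ℕ) + 1 + (n - 1 - i + 1) : ℕ) : ℂ) = (0 : ℕ) := by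
      push_cast
      linear_combination -h
    have := Nat.cast_injective this
    omega
  · have : ((n - 1 - i : ℕ) : ℂ) = (n - 1 - j : ℕ) := by linear_combination -h
    have := Nat.cast_injective this
    exact Fin.ext (by omega)

/-- The derivative of the parametrization at the base point. -/
noncomputable def anticommutingTangent :
    AnticommutingParam n →ₗ[ℂ] Matrix (Fin n) (Fin n) ℂ × Matrix (Fin n) (Fin n) ℂ where
  toFun q := (q.1 * oddDiagonal n (baseDiagonal n) - oddDiagonal n (baseDiagonal n) * q.1 +
    oddDiagonal n q.2.1, antidiagonal n q.2.2)
  map_add' q q' := by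
    refine Prod.ext ?_ ?_
    · simp only [Prod.fst_add, Prod.snd_add, map_add, add_mul, mul_add]
      abel
    · simp
  map_smul' c q := by
    refine Prod.ext ?_ ?_
    · simp only [Prod.smul_fst, Prod.smul_snd, map_smul, smul_mul_assoc, mul_smul_comm, smul_add,
        smul_sub, RingHom.id_apply]
    · simp

theorem hasStrictFDerivAt_anticommutingParam :
    HasStrictFDerivAt (anticommutingParam n)
      (LinearMap.toContinuousLinearMap (anticommutingTangent n)) (0, baseDiagonal n, 0) := by
  let p₀ : AnticommutingParam n := (0, baseDiagonal n, 0)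
  let l1 : AnticommutingParam n →L[ℂ] Matrix (Fin n) (Fin n) ℂ := ContinuousLinearMap.fst ℂ _ _
  let l2 : AnticommutingParam n →L[ℂ] Matrix (Fin n) (Fin n) ℂ :=
    LinearMap.toContinuousLinearMap (oddDiagonal n ∘ₗ LinearMap.fst ℂ _ _ ∘ₗ LinearMap.snd ℂ _ _)
  let l3 : AnticommutingParam n →L[ℂ] Matrix (Fin n) (Fin n) ℂ :=
    LinearMap.toContinuousLinearMap (antidiagonal n ∘ₗ LinearMap.snd ℂ _ _ ∘ₗ LinearMap.snd ℂ _ _)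
  have h1 : HasStrictFDerivAt (fun q : AnticommutingParam n => 1 + q.1) l1 p₀ :=
    l1.hasStrictFDerivAt.const_add 1
  have h2 : HasStrictFDerivAt (fun q : AnticommutingParam n => oddDiagonal n q.2.1) l2 p₀ :=
    l2.hasStrictFDerivAt
  have h3 : HasStrictFDerivAt (fun q : AnticommutingParam n => antidiagonal n q.2.2) l3 p₀ :=
    l3.hasStrictFDerivAt
  have h4 : HasStrictFDerivAt (fun q : AnticommutingParam n => Ring.inverse (1 + q.1)) (-l1) p₀ := by
    have h5 := hasStrictFDerivAt_ringInverse (𝕜 := ℂ) (1 : (Matrix (Fin n) (Fin n) ℂ)ˣ)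
    have h6 : (1 + p₀.1 : Matrix (Fin n) (Fin n) ℂ) = ((1 : (Matrix (Fin n) (Fin n) ℂ)ˣ) :
        Matrix (Fin n) (Fin n) ℂ) := by simp [p₀]
    rw [← h6] at h5
    refine (h5.comp p₀ h1).congr_fderiv ?_
    refine ContinuousLinearMap.ext fun q => ?_
    change -(((1 : (Matrix (Fin n) (Fin n) ℂ)ˣ)⁻¹ : (Matrix (Fin n) (Fin n) ℂ)ˣ) * q.1 *
      ((1 : (Matrix (Fin n) (Fin n) ℂ)ˣ)⁻¹ : (Matrix (Fin n) (Fin n) ℂ)ˣ)) = -q.1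
    simp
  refine (((h1.mul' h2).mul' h4).prodMk ((h1.mul' h3).mul' h4)).congr_fderiv ?_
  refine ContinuousLinearMap.ext fun q => ?_
  refine Prod.ext ?_ ?_
  · change (1 + 0) * oddDiagonal n (baseDiagonal n) * (-q.1) +
      ((1 + 0) * oddDiagonal n q.2.1 + q.1 * oddDiagonal n (baseDiagonal n)) *
        Ring.inverse (1 + 0) = q.1 * oddDiagonal n (baseDiagonal n) -
          oddDiagonal n (baseDiagonal n) * q.1 + oddDiagonal n q.2.1
    rw [add_zero, Ring.inverse_one]
    noncomm_ring
  -- The base point has antidiagonal part zero, so conjugation does not contribute to the second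
  -- component.
  · change (1 + 0) * antidiagonal n 0 * (-q.1) +
      ((1 + 0) * antidiagonal n q.2.2 + q.1 * antidiagonal n 0) * Ring.inverse (1 + 0) =
        antidiagonal n q.2.2
    rw [add_zero, Ring.inverse_one]
    simp

/-- The parameter space has dimension `n² + n + ⌊n/2⌋`. In the kernel, distinctness of the base
entries forces `w` to be diagonal and the other parameters to vanish, so the kernel has dimension at
most `n`. -/
theorem le_finrank_range_anticommutingTangent :
    n ^ 2 + n / 2 ≤ Module.finrank ℂ (anticommutingTangent n).range := by
  have h1 := (anticommutingTangent n).finrank_range_add_finrank_ker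
  have h2 : Module.finrank ℂ (AnticommutingParam n) = n ^ 2 + (n - n / 2 + (n / 2 + n / 2)) := by
    simp [Module.finrank_prod, Module.finrank_matrix, sq]
  have h3 : Module.finrank ℂ (anticommutingTangent n).ker ≤ n := by
    let δ : AnticommutingParam n →ₗ[ℂ] (Fin n → ℂ) :=
      Matrix.diagLinearMap (Fin n) ℂ ℂ ∘ₗ LinearMap.fst ℂ _ _
    have := LinearMap.finrank_le_finrank_of_injective
      (f := δ ∘ₗ (anticommutingTangent n).ker.subtype) (by
        rw [← LinearMap.ker_eq_bot, LinearMap.ker_eq_bot']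
        rintro ⟨⟨w, α, β⟩, hq⟩ hδ
        have hδ' : ∀ i, w i i = 0 := fun i => congrFun hδ i
        have hq' : anticommutingTangent n (w, α, β) = 0 := hq
        obtain ⟨hq1, hq2⟩ := Prod.ext_iff.mp hq'
        have ha : w * oddDiagonal n (baseDiagonal n) - oddDiagonal n (baseDiagonal n) * w +
          oddDiagonal n α = 0 := hq1
        have hb : antidiagonal n β = 0 := hq2
        have hentry : ∀ i j, w i j * (oddDiagonal n (baseDiagonal n) j j -
            oddDiagonal n (baseDiagonal n) i i) + oddDiagonal n α i j = 0 := by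
          intro i j
          have := congrFun (congrFun ha i) j
          simp only [oddDiagonal, LinearMap.coe_mk, AddHom.coe_mk, Matrix.add_apply,
            Matrix.sub_apply, Matrix.mul_diagonal, Matrix.diagonal_mul, Matrix.zero_apply,
            Matrix.diagonal_apply_eq] at this ⊢
          linear_combination this
        have hα : α = 0 := by
          ext k
          have hk := k.2
          have := hentry ⟨k, by omega⟩ ⟨k, by omega⟩
          simpa [oddDiagonal] using this
        have hw : w = 0 := by
          ext i j
          by_cases hij : i = j
          · subst hij; exact hδ' i
          · have h4 := hentry i j
            rw [hα, map_zero, Matrix.zero_apply, add_zero] at h4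
            refine (mul_eq_zero.mp h4).resolve_right fun h => hij ?_
            exact oddDiagonal_baseDiagonal_injective n (sub_eq_zero.mp h).symm
        have hβ : β = 0 := by
          refine Prod.ext ?_ ?_
          · ext k
            have hk := k.2
            have := congrFun (congrFun hb ⟨k, by omega⟩) ⟨n - 1 - k, by omega⟩
            have h5 : (k : ℕ) + (n - 1 - k) = n - 1 := by omega
            simpa [antidiagonal, h5] using this
          · ext k
            have hk := k.2
            have := congrFun (congrFun hb ⟨n - 1 - k, by omega⟩) ⟨k, by omega⟩
            have h5 : (n - 1 - k) + (k : ℕ) = n - 1 := by omega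
            have h6 : ¬ (n - 1 - k < n / 2) := by omega
            simpa [antidiagonal, h5, h6] using this
        have h7 : ((w, α, β) : AnticommutingParam n) = 0 := by rw [hw, hα, hβ]; rfl
        exact Subtype.ext h7)
    simpa using this
  have := Nat.div_le_self n 2
  omega

/-- Choose `L` to be onto already on the range of the tangent map. The composite then has surjective
derivative at the base point and maps neighbourhoods to neighbourhoods; close to that point `1 +
q.1` is a unit, so the parametrized pairs do anticommute. -/
theorem le_varietyDim_anticommuting :
    ((n ^ 2 + n / 2 : ℕ) : WithBot ℕ∞) ≤
      varietyDim {p : Matrix (Fin n) (Fin n) ℂ × Matrix (Fin n) (Fin n) ℂ |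
        p.1 * p.2 + p.2 * p.1 = 0} := by
  set N := n ^ 2 + n / 2
  obtain ⟨L, hL⟩ : ∃ L : Matrix (Fin n) (Fin n) ℂ × Matrix (Fin n) (Fin n) ℂ →ₗ[ℂ] (Fin N → ℂ),
      (L ∘ₗ anticommutingTangent n).range = ⊤ := by
    have hle := le_finrank_range_anticommutingTangent n
    let f : (anticommutingTangent n).range →ₗ[ℂ] (Fin N → ℂ) :=
      LinearMap.funLeft ℂ ℂ (Fin.castLE hle) ∘ₗ (LinearEquiv.ofFinrankEq _ _ (by simp)).toLinearMap
    have hf : Function.Surjective f :=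
      (LinearMap.funLeft_surjective_of_injective ℂ ℂ _ (Fin.castLE_injective hle)).comp
        (LinearEquiv.surjective _)
    obtain ⟨L, hL⟩ := f.exists_extend
    refine ⟨L, LinearMap.range_eq_top.mpr fun y => ?_⟩
    obtain ⟨⟨_, q, rfl⟩, hq⟩ := hf y
    exact ⟨q, by rw [← hq, ← hL]; rfl⟩
  refine le_varietyDim_of_interior_image_nonempty L ?_
  have hd := (LinearMap.toContinuousLinearMap L).hasStrictFDerivAt.comp
    ((0, baseDiagonal n, 0) : AnticommutingParam n) (hasStrictFDerivAt_anticommutingParam n)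
  have hmap := hd.map_nhds_eq_of_surj (by
    rw [← hL]
    rfl)
  have hU : {q : AnticommutingParam n | IsUnit (1 + q.1)} ∈
      nhds ((0, baseDiagonal n, 0) : AnticommutingParam n) := by
    have hopen : IsOpen {q : AnticommutingParam n | IsUnit (1 + q.1)} :=
      Units.isOpen.preimage (continuous_const.add continuous_fst)
    exact hopen.mem_nhds (by simp)
  have h1 := Filter.image_mem_map hU (m := fun q => L (anticommutingParam n q))
  refine ⟨_, mem_interior_iff_mem_nhds.mpr (Filter.mem_of_superset (hmap.ge h1) ?_)⟩
  rintro _ ⟨q, hq, rfl⟩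
  exact ⟨anticommutingParam n q, anticommutingParam_mem n hq, rfl⟩

end LowerBound

theorem kernelVariety_symmetrizedMatMul (n : ℕ) :
    kernelVariety (symmetrizedMatMul n) =
      {p : Matrix (Fin n) (Fin n) ℂ × Matrix (Fin n) (Fin n) ℂ | p.1 * p.2 + p.2 * p.1 = 0} := by
  ext p
  simp only [kernelVariety, Set.mem_ofPred_eq, symmetrizedMatMul_apply, ← Matrix.trace_add,
    ← add_mul]
  refine ⟨fun h => ?_, fun h γ => by rw [h]; simp⟩
  exact Matrix.ext_iff_trace_mul_right.mpr fun γ => by rw [h]; simp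

theorem varietyDim_anticommuting (n : ℕ) :
    varietyDim {p : Matrix (Fin n) (Fin n) ℂ × Matrix (Fin n) (Fin n) ℂ |
      p.1 * p.2 + p.2 * p.1 = 0} = ((n ^ 2 + n / 2 : ℕ) : WithBot ℕ∞) :=
  le_antisymm (varietyDim_anticommuting_le n) (le_varietyDim_anticommuting n)

theorem mainTheorem5 (n : ℕ) :
    kernelVariety (symmetrizedMatMul n) =
        {p : Matrix (Fin n) (Fin n) ℂ × Matrix (Fin n) (Fin n) ℂ |
          p.1 * p.2 + p.2 * p.1 = 0} ∧
      varietyDim {p : Matrix (Fin n) (Fin n) ℂ × Matrix (Fin n) (Fin n) ℂ |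
          p.1 * p.2 + p.2 * p.1 = 0} = ((n ^ 2 + n / 2 : ℕ) : WithBot ℕ∞) ∧
      geometricRank (symmetrizedMatMul n) = n ^ 2 - n / 2 := by
  refine ⟨kernelVariety_symmetrizedMatMul n, varietyDim_anticommuting n, ?_⟩
  rw [geometricRank, kernelVariety_symmetrizedMatMul, varietyDim_anticommuting]
  have h1 : Module.finrank ℂ (Matrix (Fin n) (Fin n) ℂ × Matrix (Fin n) (Fin n) ℂ) =
      n ^ 2 + n ^ 2 := by
    simp [Module.finrank_prod, Module.finrank_matrix, sq]
  have h2 : (((n ^ 2 + n / 2 : ℕ) : WithBot ℕ∞).unbotD 0).toNat = n ^ 2 + n / 2 := by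
    rfl
  rw [h1, h2]
  omega
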